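/- Let $\Pi=(\mathcal P,\mathcal L)$ be a polar space of rank $n\ge 3$. That is, $\mathcal P$ is a non-empty set of points and $\mathcal L$ is a family of proper subsets of $\mathcal P$ (lines), each with at least two points, such that two distinct points lie on at most one common line; calling two points collinear if they are equal or lie on a common line, the following axioms hold: (P1) each line contains at least three points; (P2) no point is collinear to all points; (P3) if $p\in\mathcal P$ and $L\in\mathcal L$, then $p$ is collinear to precisely one point or to all points of $L$; (P4) every flag (chain under inclusion) of singular subspaces is finite. Here a subspace is a set of points containing the line through any two of its distinct collinear points, and a singular subspace is a subspace any two points of which are collinear. Rank $n$ means that all maximal singular subspaces have projective dimension $n-1$ (the empty set has dimension $-1$, a point has dimension $0$). Let $\mathcal G_{n-2}(\Pi)$ be the set of all singular subspaces of projective dimension $n-2$. Let $\Gamma_{n-2}(\Pi)$ be the polar Grassmann graph with vertex set $\mathcal G_{n-2}(\Pi)$, in which $X,Y$ are adjacent if and only if $\dim(X^{\perp}\cap Y)=n-2$ and $\dim(X\cap Y)=n-3$, where $X^{\perp}$ is the set of all points collinear to every point of $X$. Let $f$ be a bijective transformation of $\mathcal G_{n-2}(\Pi)$ satisfying the following condition: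 for all $S,U\in\mathcal G_{n-2}(\Pi)$, the distance between $S$ and $U$ in $\Gamma_{n-2}(\Pi)$ is equal to $2$ if and only if the distance between $f(S)$ and $f(U)$ in $\Gamma_{n-2}(\Pi)$ is equal to $2$. Then $f$ is an automorphism of $\Gamma_{n-2}(\Pi)$. -/

import Mathlib

/-- A partial linear space on the point set `P`: a nonempty set of points together with a family
of proper subsets called lines, such that every line has at least two points and two distinct
points lie on at most one common line. -/
structure PartialLinearSpace (P : Type*) where
  nonempty : Nonempty P
  lines : Set (Set P)
  line_ne_univ : ∀ l ∈ lines, l ≠ Set.univ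
  line_nontrivial : ∀ l ∈ lines, l.Nontrivial
  line_unique : ∀ p q : P, p ≠ q → ∀ l ∈ lines, ∀ m ∈ lines,
    p ∈ l → q ∈ l → p ∈ m → q ∈ m → l = m

namespace PartialLinearSpace

variable {P : Type*} (G : PartialLinearSpace P)

/-- Collinearity `p ⊥ q`: the points are joined by a line. A point counts as collinear to
itself. -/
def Collinear (p q : P) : Prop :=
  p = q ∨ ∃ l ∈ G.lines, p ∈ l ∧ q ∈ l

/-- `S` is a subspace: it contains the line through any two of its distinct collinear points. -/
def IsSubspace (S : Set P) : Prop :=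
  ∀ p ∈ S, ∀ q ∈ S, p ≠ q → ∀ l ∈ G.lines, p ∈ l → q ∈ l → l ⊆ S

/-- A singular subspace: a subspace any two points of which are collinear. -/
def IsSingular (S : Set P) : Prop :=
  G.IsSubspace S ∧ ∀ p ∈ S, ∀ q ∈ S, G.Collinear p q

/-- `X^⊥`: the points collinear to all points of `X`. -/
def perp (X : Set P) : Set P :=
  {p | ∀ x ∈ X, G.Collinear p x}

/-- The set of singular subspaces, ordered by inclusion. -/
abbrev SingularSubspace : Type _ :=
  {S : Set P // G.IsSingular S}

/-- The set `S` is a singular subspace of projective dimension `d`: the longest chains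
`S₀ ⊂ S₁ ⊂ ⋯ ⊂ Sₘ = S` of singular subspaces have `m = d + 1`. So `∅` has dimension `-1`,
a point has dimension `0`, a singular line has dimension `1`, and so on. -/
def HasProjDim (S : Set P) (d : ℤ) : Prop :=
  ∃ (h : G.IsSingular S) (m : ℕ),
    Order.height (⟨S, h⟩ : G.SingularSubspace) = (m : ℕ∞) ∧ (m : ℤ) = d + 1

end PartialLinearSpace

/-- A polar space, given by the Buekenhout-Shult axioms. -/
structure PolarSpace (P : Type*) extends PartialLinearSpace P where
  three_points : ∀ l ∈ lines, ∃ a ∈ l, ∃ b ∈ l, ∃ c ∈ l, a ≠ b ∧ a ≠ c ∧ b ≠ c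
  no_radical : ¬ ∃ p : P, ∀ q : P, toPartialLinearSpace.Collinear p q
  one_or_all : ∀ p : P, ∀ l ∈ lines,
    (∃! q : P, q ∈ l ∧ toPartialLinearSpace.Collinear p q) ∨
      ∀ q ∈ l, toPartialLinearSpace.Collinear p q
  finite_flags : ∀ F : Set (Set P), (∀ S ∈ F, toPartialLinearSpace.IsSingular S) →
    IsChain (· ⊆ ·) F → F.Finite

namespace PolarSpace

variable {P : Type*} (G : PolarSpace P)

/-- The polar space has rank `n`: all its maximal singular subspaces have projective
dimension `n - 1`. -/
def HasRank (n : ℕ) : Prop :=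
  ∀ M : Set P, Maximal G.IsSingular M → G.HasProjDim M ((n : ℤ) - 1)

/-- The polar Grassmannian `𝒢ₖ(Π)` of all singular subspaces of projective dimension `k`. -/
def Grassmannian (k : ℤ) : Type _ :=
  {S : Set P // G.HasProjDim S k}

/-- The relation `ℜᵢⱼ` on `𝒢ₖ(Π)`: `dim (X^⊥ ∩ Y) = k - i` and `dim (X ∩ Y) = k - j`. -/
def Rel (k i j : ℤ) (X Y : G.Grassmannian k) : Prop :=
  G.HasProjDim (G.perp X.1 ∩ Y.1) (k - i) ∧ G.HasProjDim (X.1 ∩ Y.1) (k - j)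

theorem hasProjDim_unique {S : Set P} {d e : ℤ} (hd : G.HasProjDim S d)
    (he : G.HasProjDim S e) : d = e := by
  obtain ⟨_, m, hm, hmd⟩ := hd
  obtain ⟨_, m', hm', hme⟩ := he
  have : m = m' := by
    rw [hm] at hm'
    exact_mod_cast hm'
  omega

theorem eq_of_hasProjDim {S T : Set P} {d : ℤ} (hS : G.HasProjDim S d)
    (hT : G.HasProjDim T d) (hST : S ⊆ T) : S = T := by
  obtain ⟨h, m, hm, hmd⟩ := hS
  obtain ⟨h', m', hm', hmd'⟩ := hT
  have hmm : m = m' := by omega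
  subst hmm
  by_contra hne
  have hlt : (⟨S, h⟩ : G.SingularSubspace) < ⟨T, h'⟩ :=
    lt_of_le_of_ne hST fun he => hne (congrArg Subtype.val he)
  have hlt' := Order.height_strictMono hlt (by rw [hm]; exact ENat.natCast_lt_top m)
  rw [hm, hm'] at hlt'
  exact lt_irrefl _ hlt'

theorem collinear_symm {p q : P} (h : G.Collinear p q) : G.Collinear q p := by
  rcases h with h | ⟨l, hl, hp, hq⟩
  · exact Or.inl h.symm
  · exact Or.inr ⟨l, hl, hq, hp⟩

theorem rel_zero_one_symm {k : ℤ} {X Y : G.Grassmannian k} (h : G.Rel k 0 1 X Y) :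
    G.Rel k 0 1 Y X := by
  obtain ⟨h1, h2⟩ := h
  rw [sub_zero] at h1
  have hY : G.perp X.1 ∩ Y.1 = Y.1 := G.eq_of_hasProjDim h1 Y.2 Set.inter_subset_right
  have hX : G.perp Y.1 ∩ X.1 = X.1 := by
    refine Set.inter_eq_right.2 fun x hx y hy => ?_
    exact G.collinear_symm (Set.inter_eq_right.1 hY hy x hx)
  refine ⟨?_, ?_⟩
  · rw [hX, sub_zero]
    exact X.2
  · rw [Set.inter_comm]
    exact h2

/-- The polar Grassmann graph `Γₖ(Π) = (𝒢ₖ(Π), ℜ₀₁)`. -/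
def grassmannGraph (k : ℤ) : SimpleGraph (G.Grassmannian k) where
  Adj X Y := G.Rel k 0 1 X Y
  symm := ⟨fun _ _ h => G.rel_zero_one_symm h⟩
  loopless := ⟨fun X h => by
    have h2 := h.2
    rw [Set.inter_self] at h2
    have := G.hasProjDim_unique X.2 h2
    omega⟩

end PolarSpace

/-!
Vertices are the singular subspaces of height `n - 1`. Two distinct vertices are adjacent exactly
when they lie in a common maximal singular subspace `M`, so the graph is covered by its stars `[M]`,
the sets of vertices inside `M`; a star is a linear space whose lines are the pencils of hyperplanes
of `M` through a subspace of codimension two. Write `D` for the relation of being at distance two.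
It holds for `x`, `z` if and only if `x^⊥ ∩ z` is a hyperplane of `z`
(`PolarSpace.dist_eq_two_iff`).
Hence the `D`-neighbours of a vertex in a star are described by one subspace `z^⊥ ∩ M`: they form
the empty set, the complement of a point, or a line (`PolarSpace.star_pattern`).

Pulling the stars back along `f` gives a second star geometry `H` on the same vertices with the same
relation `D`, and it suffices to show that two star geometries `G`, `H` with the same `D` have the
same adjacency (`StarGeometry.Adj.of_adj`). This is a comparison of patterns.

* If an `H`-star and a `G`-star share two points, they coincide (`StarGeometry.star_eq_star`): the
  patterns of the points of a neighbouring `G`-star on the `H`-star, read in both directions, force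
  almost all points of the `H`-star into the `G`-star, and four common points are enough.
* Every `H`-star `C` contains two `G`-adjacent points (`StarGeometry.exists_adj_of_star`). Otherwise
  `C` has two points `s`, `u` with distinct `G`-neighbours `t₁`, `t₂` in a `G`-star `N` containing
  neither of them. A third point `v` of the `H`-line `su` is not at distance two from `t₁` or `t₂`,
  so its pattern on `N` lies on a line. The remaining points of `N` see `s` and `u` but not `v`
  (that is, are in relation `D` to the former only), hence are `H`-adjacent to `v`; two of them span an `H`-star through `v` equal to `N`, which is
  absurd (`StarGeometry.false_of_two_feet`).

The geometric input is that adjoining a point `p ∈ X^⊥` outside `X` to a singular subspace `X`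
yields a singular subspace in which `X` is a hyperplane (`PolarSpace.isHyperplane_adjoin`). It is
derived directly from the axioms, using that singular subspaces of finite height are determined by their perps.
-/

/-! ### Linear spaces of stars and their comparison -/

/-- A geometry of stars on a set `V` carrying a distance-two relation `D`: stars are the sets of
all vertices inside a maximal object, two vertices are adjacent when they lie in a common star, and
each star is a linear space (with at least three points on a line, not all points on one line) in
which the `D`-neighbours of a vertex form nothing, the complement of a point, or a line. -/
structure StarGeometry {V : Type*} (D : V → V → Prop) where
  stars : Set (Set V)
  lines : Set (Set V)
  symm : ∀ {x y}, D x y → D y x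
  star_unique : ∀ {C C' x y}, C ∈ stars → C' ∈ stars → x ≠ y → x ∈ C → y ∈ C → x ∈ C' → y ∈ C' →
    C = C'
  not_dist : ∀ {C x y}, C ∈ stars → x ∈ C → y ∈ C → ¬ D x y
  exists_line : ∀ {C x y}, C ∈ stars → x ∈ C → y ∈ C → x ≠ y → ∃ l ∈ lines, l ⊆ C ∧ x ∈ l ∧ y ∈ l
  line_unique : ∀ {l m x y}, l ∈ lines → m ∈ lines → x ≠ y → x ∈ l → y ∈ l → x ∈ m → y ∈ m → l = m
  exists_third : ∀ {l}, l ∈ lines → ∀ x y, ∃ z ∈ l, z ≠ x ∧ z ≠ y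
  exists_notMem_line : ∀ {C l}, C ∈ stars → l ∈ lines → ∃ z ∈ C, z ∉ l
  exists_line_subset : ∀ {C}, C ∈ stars → ∃ l ∈ lines, l ⊆ C
  exists_other_star : ∀ {C x}, C ∈ stars → x ∈ C → ∃ C' ∈ stars, x ∈ C' ∧ C' ≠ C
  /-- Adjacent pairs `x, y` and `y, z` with `x, z` not at distance two form a triangle, and
  triangles lie in stars. -/
  triangle : ∀ {C C' x y z}, C ∈ stars → C' ∈ stars → x ∈ C → y ∈ C → y ∈ C' → z ∈ C' → ¬ D x z →
    ∃ C'' ∈ stars, x ∈ C'' ∧ y ∈ C'' ∧ z ∈ C''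
  pattern : ∀ {C}, C ∈ stars → ∀ z, (∀ x ∈ C, ¬ D z x) ∨
    (∃ t ∈ C, (∃ C' ∈ stars, z ∈ C' ∧ t ∈ C') ∧ ∀ x ∈ C, D z x ↔ x ≠ t) ∨
    ∃ l ∈ lines, l ⊆ C ∧ ∀ x ∈ C, D z x ↔ x ∈ l
  exists_between : ∀ {x z}, D x z → ∃ y, ∃ C ∈ stars, ∃ C' ∈ stars, x ∈ C ∧ y ∈ C ∧ y ∈ C' ∧ z ∈ C'
  /-- For every vertex `x` some vertex `r` is so close to `x` that every star through `r` contains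
  a neighbour of `x`. -/
  exists_close : ∀ x, ∃ r, D x r ∧
    ∀ C ∈ stars, r ∈ C → ∃ y ∈ C, ∃ C' ∈ stars, x ∈ C' ∧ y ∈ C'

namespace StarGeometry

variable {V : Type*} {D : V → V → Prop} (G H : StarGeometry D)

/-- Adjacency: distinct vertices in a common star. -/
def Adj (x y : V) : Prop :=
  x ≠ y ∧ ∃ C ∈ G.stars, x ∈ C ∧ y ∈ C

section LinearSpace

variable {C l m : Set V}

/-- The complement of a line in a star has at least four points. -/
theorem exists_notMem_line_ne (hC : C ∈ G.stars) (hl : l ∈ G.lines) (hlC : l ⊆ C) (a b c : V) :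
    ∃ z ∈ C, z ∉ l ∧ z ≠ a ∧ z ≠ b ∧ z ≠ c := by
  classical
  obtain ⟨o, hoC, hol⟩ := G.exists_notMem_line hC hl
  obtain ⟨a₁, ha₁, -⟩ := G.exists_third hl o o
  obtain ⟨a₂, ha₂, h21, -⟩ := G.exists_third hl a₁ a₁
  obtain ⟨a₃, ha₃, h31, h32⟩ := G.exists_third hl a₁ a₂
  have key : ∀ x ∈ l, ∃ z ∈ C, z ∉ l ∧ z ≠ o ∧ ∃ k ∈ G.lines, o ∈ k ∧ x ∈ k ∧ z ∈ k := by
    intro x hx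
    have hox : o ≠ x := fun h => hol (h ▸ hx)
    obtain ⟨k, hk, hkC, hok, hxk⟩ := G.exists_line hC hoC (hlC hx) hox
    obtain ⟨z, hz, hzo, hzx⟩ := G.exists_third hk o x
    refine ⟨z, hkC hz, fun hzl => ?_, hzo, k, hk, hok, hxk, hz⟩
    exact hol (G.line_unique hk hl hzx hz hxk hzl hx ▸ hok)
  have ne : ∀ {x y z w k k'}, x ∈ l → y ∈ l → x ≠ y → k ∈ G.lines → k' ∈ G.lines → o ∈ k →
      x ∈ k → z ∈ k → o ∈ k' → y ∈ k' → w ∈ k' → z ≠ o → z ≠ w := by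
    intro x y z w k k' hx hy hxy hk hk' hok hxk hzk hok' hyk' hwk' hzo hzw
    subst hzw
    have := G.line_unique hk hk' hzo hzk hok hwk' hok'
    subst this
    exact hol (G.line_unique hk hl hxy hxk hyk' hx hy ▸ hok)
  obtain ⟨z₁, hz₁C, hz₁l, hz₁o, k₁, hk₁, ho₁, hx₁, hzk₁⟩ := key a₁ ha₁
  obtain ⟨z₂, hz₂C, hz₂l, hz₂o, k₂, hk₂, ho₂, hx₂, hzk₂⟩ := key a₂ ha₂
  obtain ⟨z₃, hz₃C, hz₃l, hz₃o, k₃, hk₃, ho₃, hx₃, hzk₃⟩ := key a₃ ha₃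
  have h12 : z₁ ≠ z₂ := ne ha₁ ha₂ h21.symm hk₁ hk₂ ho₁ hx₁ hzk₁ ho₂ hx₂ hzk₂ hz₁o
  have h13 : z₁ ≠ z₃ := ne ha₁ ha₃ h31.symm hk₁ hk₃ ho₁ hx₁ hzk₁ ho₃ hx₃ hzk₃ hz₁o
  have h23 : z₂ ≠ z₃ := ne ha₂ ha₃ h32.symm hk₂ hk₃ ho₂ hx₂ hzk₂ ho₃ hx₃ hzk₃ hz₂o
  have hcard : ({a, b, c} : Finset V).card < ({o, z₁, z₂, z₃} : Finset V).card := by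
    have h4 : ({o, z₁, z₂, z₃} : Finset V).card = 4 := by
      rw [Finset.card_eq_succ]
      refine ⟨o, {z₁, z₂, z₃}, ?_, rfl, ?_⟩
      · simp [hz₁o.symm, hz₂o.symm, hz₃o.symm]
      · exact Finset.card_eq_three.2 ⟨z₁, z₂, z₃, h12, h13, h23, rfl⟩
    have h3 : ({a, b, c} : Finset V).card ≤ 3 := Finset.card_le_three
    omega
  obtain ⟨z, hz, hzn⟩ := Finset.exists_mem_notMem_of_card_lt_card hcard
  simp only [Finset.mem_insert, Finset.mem_singleton, not_or] at hz hzn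
  refine ⟨z, ?_, ?_, hzn⟩ <;> rcases hz with rfl | rfl | rfl | rfl <;> assumption

/-- A star is not the union of two lines and a point. -/
theorem exists_notMem_two_lines (hC : C ∈ G.stars) (hl : l ∈ G.lines) (hlC : l ⊆ C)
    (hm : m ∈ G.lines) (hmC : m ⊆ C) (t : V) : ∃ z ∈ C, z ∉ l ∧ z ∉ m ∧ z ≠ t := by
  by_cases hlm : l = m
  · subst hlm
    obtain ⟨z, hz, hzl, hzt, -⟩ := G.exists_notMem_line_ne hC hl hlC t t t
    exact ⟨z, hz, hzl, hzl, hzt⟩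
  obtain ⟨x, hxl, hx⟩ : ∃ x ∈ l, ∀ y ∈ l, y ∈ m → y = x := by
    by_cases h : ∃ x ∈ l, x ∈ m
    · obtain ⟨x, hxl, hxm⟩ := h
      refine ⟨x, hxl, fun y hyl hym => ?_⟩
      by_contra hyx
      exact hlm (G.line_unique hl hm hyx hyl hxl hym hxm)
    · obtain ⟨x, hxl, -⟩ := G.exists_third hl t t
      exact ⟨x, hxl, fun y hyl hym => absurd ⟨y, hyl, hym⟩ h⟩
  obtain ⟨a, hal, hax, -⟩ := G.exists_third hl x x
  obtain ⟨b, hbm, hbx, -⟩ := G.exists_third hm x x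
  obtain ⟨b', hbm', hbx', hbb'⟩ := G.exists_third hm x b
  have ham : a ∉ m := fun h => hax (hx a hal h)
  have hbl : b ∉ l := fun h => hbx (hx b h hbm)
  have hbl' : b' ∉ l := fun h => hbx' (hx b' h hbm')
  have key : ∀ y ∈ m, y ∉ l → ∃ z ∈ C, z ∉ l ∧ z ∉ m ∧ z ≠ a ∧
      ∃ k ∈ G.lines, a ∈ k ∧ y ∈ k ∧ z ∈ k := by
    intro y hym hyl
    have hay : a ≠ y := fun h => ham (h ▸ hym)
    obtain ⟨k, hk, hkC, hak, hyk⟩ := G.exists_line hC (hlC hal) (hmC hym) hay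
    obtain ⟨z, hz, hza, hzy⟩ := G.exists_third hk a y
    refine ⟨z, hkC hz, fun hzl => ?_, fun hzm => ?_, hza, k, hk, hak, hyk, hz⟩
    · exact hyl (G.line_unique hk hl hza hz hak hzl hal ▸ hyk)
    · exact ham (G.line_unique hk hm hzy hz hyk hzm hym ▸ hak)
  obtain ⟨z, hzC, hzl, hzm, hza, k, hk, hak, hbk, hzk⟩ := key b hbm hbl
  obtain ⟨z', hzC', hzl', hzm', hza', k', hk', hak', hbk', hzk'⟩ := key b' hbm' hbl'
  by_cases hzt : z = t
  · refine ⟨z', hzC', hzl', hzm', fun hzt' => ?_⟩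
    have hzz : z' = z := hzt'.trans hzt.symm
    subst hzz
    have := G.line_unique hk hk' hza hzk hak hzk' hak'
    subst this
    exact ham (G.line_unique hk hm hbb' hbk' hbk hbm' hbm ▸ hak)
  · exact ⟨z, hzC, hzl, hzm, hzt⟩

/-- Off a line missing three collinear points `a`, `b`, `w` there are two further points. -/
theorem exists_two_notMem_line (hC : C ∈ G.stars) (hl : l ∈ G.lines) (hlC : l ⊆ C)
    (hm : m ∈ G.lines) (hmC : m ⊆ C) {a b w : V} (hal : a ∈ l) (hbl : b ∈ l) (hwl : w ∈ l)
    (hab : a ≠ b) (ham : a ∉ m) :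
    ∃ y ∈ C, ∃ z ∈ C, y ∉ m ∧ z ∉ m ∧ y ∉ l ∧ y ≠ z ∧ z ≠ a ∧ z ≠ b ∧ z ≠ w := by
  obtain ⟨y, hyC, hyl, hym, -⟩ := G.exists_notMem_two_lines hC hl hlC hm hmC a
  have hya : y ≠ a := fun h => hyl (h ▸ hal)
  have hyb : y ≠ b := fun h => hyl (h ▸ hbl)
  obtain ⟨k, hk, hkC, hak, hyk⟩ := G.exists_line hC (hlC hal) hyC hya.symm
  obtain ⟨s, hsk, hsa, hsy⟩ := G.exists_third hk a y
  have hsl : s ∉ l := fun h => hyl (G.line_unique hk hl hsa hsk hak h hal ▸ hyk)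
  obtain ⟨k', hk', hkC', hbk', hyk'⟩ := G.exists_line hC (hlC hbl) hyC hyb.symm
  obtain ⟨s', hsk', hsb', hsy'⟩ := G.exists_third hk' b y
  have hsl' : s' ∉ l := fun h => hyl (G.line_unique hk' hl hsb' hsk' hbk' h hbl ▸ hyk')
  by_cases hsm' : s' ∈ m
  · have has' : a ≠ s' := fun h => ham (h ▸ hsm')
    obtain ⟨h, hh, hhC, hah, hsh⟩ := G.exists_line hC (hlC hal) (hkC' hsk') has'
    obtain ⟨z, hzh, hza, hzs⟩ := G.exists_third hh a s'
    have hzl : z ∉ l := fun hz => hsl' (G.line_unique hh hl hza hzh hah hz hal ▸ hsh)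
    refine ⟨y, hyC, z, hhC hzh, hym, fun hzm => ?_, hyl, fun hyz => ?_, hza,
      fun e => hzl (e ▸ hbl), fun e => hzl (e ▸ hwl)⟩
    · exact ham (G.line_unique hh hm hzs hzh hsh hzm hsm' ▸ hah)
    · subst hyz
      have := G.line_unique hh hk' hzs hzh hsh hyk' hsk'
      subst this
      exact hyl (G.line_unique hh hl hab hah hbk' hal hbl ▸ hzh)
  · exact ⟨y, hyC, s', hkC' hsk', hym, hsm', hyl, hsy'.symm, fun e => hsl' (e ▸ hal), hsb',
      fun e => hsl' (e ▸ hwl)⟩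

end LinearSpace

section Pattern

variable {C C' : Set V}

/-- A vertex `z ∉ C` adjacent to a point `t` of the star `C` is at distance two from all other
points of `C`, since triangles lie in stars. -/
theorem dist_of_notMem (hC : C ∈ G.stars) (hC' : C' ∈ G.stars) {t x z : V} (hz : z ∈ C')
    (ht' : t ∈ C') (ht : t ∈ C) (hx : x ∈ C) (hxt : x ≠ t) (hzC : z ∉ C) : D z x := by
  by_contra h
  obtain ⟨C'', h'', hz'', ht'', hx''⟩ := G.triangle hC' hC hz ht' ht hx h
  exact hzC (G.star_unique hC h'' hxt hx ht hx'' ht'' ▸ hz'')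

/-- The `D`-neighbours of `z` in a star lie on a line unless they form the complement of
a point. -/
theorem pattern_or (hC : C ∈ G.stars) (z : V) :
    (∃ t ∈ C, (∃ C' ∈ G.stars, z ∈ C' ∧ t ∈ C') ∧ ∀ x ∈ C, D z x ↔ x ≠ t) ∨
      ∃ l ∈ G.lines, l ⊆ C ∧ ∀ x ∈ C, D z x → x ∈ l := by
  rcases G.pattern hC z with h | h | ⟨l, hl, hlC, h⟩
  · obtain ⟨l, hl, hlC⟩ := G.exists_line_subset hC
    exact Or.inr ⟨l, hl, hlC, fun x hx hd => absurd hd (h x hx)⟩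
  · exact Or.inl h
  · exact Or.inr ⟨l, hl, hlC, fun x hx => (h x hx).1⟩

end Pattern

section TwoGeometries

variable {G H} {C M N : Set V}

/-- If the points other than `t` common to an `H`-star `C` and a `G`-star `M` lie on no line of `C`
missing `t`, then `C ⊆ M`: for a second `G`-star `N` through `t`, all points of `N` except `t` have
the same `D`-neighbours in `C`, namely everything but `t`. -/
theorem subset_of_mem_line (hC : C ∈ H.stars) (hM : M ∈ G.stars) {t a : V} (htC : t ∈ C)
    (htM : t ∈ M) (haC : a ∈ C) (haM : a ∈ M) (hat : a ≠ t)
    (hline : ∀ l ∈ H.lines, l ⊆ C → (∀ x ∈ C, x ∈ M → x ≠ t → x ∈ l) → t ∈ l) : C ⊆ M := by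
  obtain ⟨N, hN, htN, hNM⟩ := G.exists_other_star hM htM
  have hdist : ∀ x ∈ M, x ≠ t → ∀ r ∈ N, r ≠ t → D r x := fun x hx hxt r hr hrt =>
    G.dist_of_notMem hM hN hr htN htM hx hxt
      fun hrM => hNM (G.star_unique hN hM hrt hr htN hrM htM)
  have hrow : ∀ r ∈ N, r ≠ t → ∀ w ∈ C, w ≠ t → D r w := by
    intro r hr hrt
    have hrt' : ¬ D r t := G.not_dist hN hr htN
    rcases H.pattern hC r with h | ⟨s, hs, -, h⟩ | ⟨l, hl, hlC, h⟩
    · exact absurd (hdist a haM hat r hr hrt) (h a haC)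
    · have hst : t = s := by
        by_contra hts
        exact hrt' ((h t htC).2 hts)
      subst hst
      exact fun w hw => (h w hw).2
    · exact absurd ((h t htC).2 (hline l hl hlC fun x hxC hxM hxt =>
        (h x hxC).1 (hdist x hxM hxt r hr hrt))) hrt'
  intro w hw
  by_cases hwt : w = t
  · exact hwt ▸ htM
  have hwt' : ¬ D w t := H.not_dist hC hw htC
  rcases G.pattern_or hN w with ⟨s, hs, ⟨C', hC', hwC', hsC'⟩, h⟩ | ⟨l, hl, hlN, h⟩
  · have hst : t = s := by
      by_contra hts
      exact hwt' ((h t htN).2 hts)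
    subst hst
    obtain ⟨C'', h'', hw'', ht'', ha''⟩ :=
      G.triangle hC' hM hwC' hsC' htM haM (H.not_dist hC hw haC)
    exact G.star_unique h'' hM hat ha'' ht'' haM htM ▸ hw''
  · obtain ⟨r, hr, hrl, hrt, -⟩ := G.exists_notMem_line_ne hN hl hlN t t t
    exact absurd (h r hr (G.symm (hrow r hr hrt w hw hwt))) hrl

theorem subset_of_four (hC : C ∈ H.stars) (hM : M ∈ G.stars) {a b c d : V} (haC : a ∈ C)
    (hbC : b ∈ C) (hcC : c ∈ C) (hdC : d ∈ C) (haM : a ∈ M) (hbM : b ∈ M) (hcM : c ∈ M)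
    (hdM : d ∈ M) (hab : a ≠ b) (hac : a ≠ c) (had : a ≠ d) (hbc : b ≠ c) (hbd : b ≠ d)
    (hcd : c ≠ d) : C ⊆ M := by
  by_cases h : ∃ l ∈ H.lines, l ⊆ C ∧ b ∈ l ∧ c ∈ l ∧ d ∈ l
  · obtain ⟨l, hl, hlC, hbl, hcl, hdl⟩ := h
    refine subset_of_mem_line hC hM hbC hbM hcC hcM hbc.symm fun m hm hmC hall => ?_
    exact H.line_unique hl hm hcd hcl hdl (hall c hcC hcM hbc.symm) (hall d hdC hdM hbd.symm) ▸ hbl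
  · refine subset_of_mem_line hC hM haC haM hbC hbM hab.symm fun m hm hmC hall => ?_
    exact absurd ⟨m, hm, hmC, hall b hbC hbM hab.symm, hall c hcC hcM hac.symm,
      hall d hdC hdM had.symm⟩ h

/-- An `H`-star `C` sharing two points `a`, `b` with a `G`-star `M` is contained in it. If a third
point `w` of the line `ab` is not in `M`, a suitable `t ∈ M` and a second `G`-star `N` through `t`
are chosen so that most points of `N` see all of `C` except `w`. Then every point of `C` other than
`w` that is not at distance two from `t` is adjacent to `t`, hence lies in `M`, and there are at
least four of these. -/
theorem star_subset_star (hC : C ∈ H.stars) (hM : M ∈ G.stars) {a b : V} (haC : a ∈ C)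
    (hbC : b ∈ C) (haM : a ∈ M) (hbM : b ∈ M) (hab : a ≠ b) : C ⊆ M := by
  obtain ⟨l, hl, hlC, hal, hbl⟩ := H.exists_line hC haC hbC hab
  obtain ⟨w, hwl, hwa, hwb⟩ := H.exists_third hl a b
  have hwC : w ∈ C := hlC hwl
  by_cases hwM : w ∈ M
  · exact subset_of_mem_line hC hM hwC hwM haC haM hwa.symm fun m hm hmC hall =>
      H.line_unique hl hm hab hal hbl (hall a haC haM hwa.symm) (hall b hbC hbM hwb.symm) ▸ hwl
  have hwa' : ¬ D w a := H.not_dist hC hwC haC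
  have hwb' : ¬ D w b := H.not_dist hC hwC hbC
  -- A vertex of `C` with a `G`-neighbour in `M` other than `a` lies in `M`.
  have hmemM : ∀ x ∈ C, ∀ s ∈ M, s ≠ a → (∃ C' ∈ G.stars, x ∈ C' ∧ s ∈ C') → x ∈ M := by
    rintro x hx s hs hsa ⟨C', hC', hxC', hsC'⟩
    obtain ⟨C'', h'', hx'', hs'', ha''⟩ :=
      G.triangle hC' hM hxC' hsC' hs haM (H.not_dist hC hx haC)
    exact G.star_unique h'' hM hsa hs'' ha'' hs haM ▸ hx''
  obtain ⟨k, hk, hkM, hwk⟩ : ∃ k ∈ G.lines, k ⊆ M ∧ ∀ x ∈ M, D w x → x ∈ k := by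
    refine (G.pattern_or hM w).resolve_left ?_
    rintro ⟨s, hs, hs', h⟩
    by_cases hsa : s = a
    · exact hwb' ((h b hbM).2 fun e => hab (hsa.symm.trans e.symm))
    · exact hwM (hmemM w hwC s hs hsa hs')
  obtain ⟨t, htM, htk, hta, htb, -⟩ := G.exists_notMem_line_ne hM hk hkM a b b
  have hwt : ¬ D w t := fun h => htk (hwk t htM h)
  obtain ⟨N, hN, htN, hNM⟩ := G.exists_other_star hM htM
  have hdist : ∀ x ∈ M, x ≠ t → ∀ r ∈ N, r ≠ t → D r x := fun x hx hxt r hr hrt =>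
    G.dist_of_notMem hM hN hr htN htM hx hxt
      fun hrM => hNM (G.star_unique hN hM hrt hr htN hrM htM)
  obtain ⟨j, hj, hjN, hwj⟩ : ∃ j ∈ G.lines, j ⊆ N ∧ ∀ x ∈ N, D w x → x ∈ j := by
    refine (G.pattern_or hN w).resolve_left ?_
    rintro ⟨s, hs, hs', h⟩
    have hst : t = s := by
      by_contra hts
      exact hwt ((h t htN).2 hts)
    subst hst
    exact hwM (hmemM w hwC t htM hta hs')
  -- Points of `N` off `j` and different from `t` miss exactly `w` in `C`.
  have hrow : ∀ r ∈ N, r ∉ j → r ≠ t → ∀ x ∈ C, x ≠ w → D r x := by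
    intro r hr hrj hrt
    have hrw : ¬ D r w := fun h => hrj (hwj r hr (G.symm h))
    have hra : D r a := hdist a haM hta.symm r hr hrt
    have hrb : D r b := hdist b hbM htb.symm r hr hrt
    rcases H.pattern hC r with h | ⟨s, hs, -, h⟩ | ⟨m, hm, hmC, h⟩
    · exact absurd hra (h a haC)
    · have hsw : w = s := by
        by_contra hne
        exact hrw ((h w hwC).2 hne)
      subst hsw
      exact fun x hx => (h x hx).2
    · have := H.line_unique hl hm hab hal hbl ((h a haC).1 hra) ((h b hbC).1 hrb)
      exact absurd ((h w hwC).2 (this ▸ hwl)) hrw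
  have hmem : ∀ x ∈ C, x ≠ w → ¬ D t x → x ∈ M := by
    intro x hx hxw htx
    rcases G.pattern_or hN x with ⟨s, hs, hs', h⟩ | ⟨m, hm, hmN, h⟩
    · have hst : t = s := by
        by_contra hts
        exact htx (G.symm ((h t htN).2 hts))
      subst hst
      exact hmemM x hx t htM hta hs'
    · obtain ⟨r, hr, hrj, hrm, hrt⟩ := G.exists_notMem_two_lines hN hj hjN hm hmN t
      exact absurd (h r hr (G.symm (hrow r hr hrj hrt x hx hxw))) hrm
  have hta' : ¬ D t a := G.not_dist hM htM haM
  have htb' : ¬ D t b := G.not_dist hM htM hbM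
  have hfour : ∀ y ∈ C, ∀ z ∈ C, ¬ D t y → ¬ D t z → y ∉ l → y ≠ z → z ≠ a → z ≠ b → z ≠ w →
      C ⊆ M := by
    intro y hy z hz hty htz hyl hyz hza hzb hzw
    exact subset_of_four hC hM haC hbC hy hz haM hbM
      (hmem y hy (fun e => hyl (e ▸ hwl)) hty) (hmem z hz hzw htz) hab
      (fun e => hyl (e ▸ hal)) hza.symm (fun e => hyl (e ▸ hbl)) hzb.symm hyz
  rcases H.pattern hC t with h | ⟨s, hs, -, h⟩ | ⟨m, hm, hmC, h⟩
  · obtain ⟨y, hy, hyl, -⟩ := H.exists_notMem_line_ne hC hl hlC a a a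
    obtain ⟨z, hz, hzl, hzy, -⟩ := H.exists_notMem_line_ne hC hl hlC y y y
    exact hfour y hy z hz (h y hy) (h z hz) hyl hzy.symm (fun e => hzl (e ▸ hal))
      (fun e => hzl (e ▸ hbl)) (fun e => hzl (e ▸ hwl))
  · have hsa : a = s := by
      by_contra hne
      exact hta' ((h a haC).2 hne)
    exact absurd ((h b hbC).2 fun e => hab (hsa.trans e.symm)) htb'
  · obtain ⟨y, hy, z, hz, hym, hzm, hyl, hyz, hza, hzb, hzw⟩ :=
      H.exists_two_notMem_line hC hl hlC hm hmC hal hbl hwl hab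
        (fun e => hta' ((h a haC).2 e))
    exact hfour y hy z hz (fun e => hym ((h y hy).1 e)) (fun e => hzm ((h z hz).1 e)) hyl hyz hza
      hzb hzw

/-- Stars of the two geometries that share two points are equal. -/
theorem star_eq_star (hC : C ∈ H.stars) (hM : M ∈ G.stars) {a b : V} (haC : a ∈ C)
    (hbC : b ∈ C) (haM : a ∈ M) (hbM : b ∈ M) (hab : a ≠ b) : C = M :=
  (star_subset_star hC hM haC hbC haM hbM hab).antisymm
    (star_subset_star hM hC haM hbM haC hbC hab)

/-- If `s ∈ C` and `s`, `t` are adjacent in both geometries, then `s` is `G`-adjacent to every other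
point of the `H`-star `C`. -/
theorem adj_of_common_edge (hC : C ∈ H.stars) {s t u : V} (hs : s ∈ C) (hu : u ∈ C) (hus : u ≠ s)
    (hG : G.Adj s t) (hH : H.Adj s t) : G.Adj u s := by
  obtain ⟨hst, M, hM, hsM, htM⟩ := hG
  obtain ⟨-, C', hC', hsC', htC'⟩ := hH
  have hCM : C' = M := star_eq_star hC' hM hsC' htC' hsM htM hst
  subst hCM
  refine ⟨hus, ?_⟩
  by_cases huM : u ∈ C'
  · exact ⟨C', hM, huM, hsM⟩
  have hd : ∀ x ∈ C', x ≠ s → D u x := fun x hx hxs =>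
    H.dist_of_notMem hC' hC hu hs hsC' hx hxs huM
  rcases G.pattern_or hM u with ⟨r, hr, ⟨C'', h'', hu'', hr''⟩, h⟩ | ⟨l, hl, hlM, h⟩
  · have hrs : s = r := by
      by_contra hne
      exact H.not_dist hC hu hs ((h s hsM).2 hne)
    subst hrs
    exact ⟨C'', h'', hu'', hr''⟩
  · obtain ⟨x, hx, hxl, hxs, -⟩ := G.exists_notMem_line_ne hM hl hlM s s s
    exact absurd (h x hx (hd x hx hxs)) hxl

/-- By comparing patterns on `C` and `N`, the following configuration is impossible: `s`, `u` in an
`H`-star `C`, neither in the `G`-star `N`, with distinct `G`-neighbours `t₁`, `t₂` in `N`, and no two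
points of `C` being `G`-adjacent. -/
theorem false_of_two_feet (hC : C ∈ H.stars) (hN : N ∈ G.stars)
    (hno : ∀ x ∈ C, ∀ y ∈ C, ¬ G.Adj x y) {s u t₁ t₂ : V} (hs : s ∈ C) (hu : u ∈ C) (hsu : s ≠ u)
    (hsN : s ∉ N) (huN : u ∉ N) (ht₁ : t₁ ∈ N) (ht₂ : t₂ ∈ N) (ht : t₁ ≠ t₂)
    (hst : ∃ C' ∈ G.stars, s ∈ C' ∧ t₁ ∈ C') (hut : ∃ C' ∈ G.stars, u ∈ C' ∧ t₂ ∈ C') :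
    False := by
  obtain ⟨C₁, hC₁, hsC₁, htC₁⟩ := hst
  obtain ⟨C₂, hC₂, huC₂, htC₂⟩ := hut
  have hds : ∀ x ∈ N, x ≠ t₁ → D s x := fun x hx hxt =>
    G.dist_of_notMem hN hC₁ hsC₁ htC₁ ht₁ hx hxt hsN
  have hdu : ∀ x ∈ N, x ≠ t₂ → D u x := fun x hx hxt =>
    G.dist_of_notMem hN hC₂ huC₂ htC₂ ht₂ hx hxt huN
  obtain ⟨l, hl, hlC, hsl, hul⟩ := H.exists_line hC hs hu hsu
  obtain ⟨v, hvl, hvs, hvu⟩ := H.exists_third hl s u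
  have hvC : v ∈ C := hlC hvl
  -- A vertex `r` that sees `q` and is `G`-adjacent to `p` does not see `v`: its pattern on `C` is a
  -- line through `q` missing `p`.
  have foot : ∀ {p q r : V}, p ∈ C → q ∈ C → p ∈ l → q ∈ l → p ≠ q → v ≠ q → G.Adj p r → D q r →
      ¬ D v r := by
    intro p q r hp hq hpl hql hpq hvq hpr hqr hvr
    have hnpr : ¬ D r p := by
      obtain ⟨-, C', hC', hpC', hrC'⟩ := hpr
      exact G.not_dist hC' hrC' hpC'
    rcases H.pattern hC r with h | ⟨x, hx, ⟨C', hC', hrC', hxC'⟩, h⟩ | ⟨m, hm, hmC, h⟩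
    · exact h q hq (G.symm hqr)
    · have hpx : p = x := by
        by_contra hne
        exact hnpr ((h p hp).2 hne)
      subst hpx
      exact hno q hq p hp
        (adj_of_common_edge hC hp hq hpq.symm hpr ⟨hpr.1, C', hC', hxC', hrC'⟩)
    · have := H.line_unique hl hm hvq hvl hql ((h v hvC).1 (G.symm hvr)) ((h q hq).1 (G.symm hqr))
      exact hnpr ((h p hp).2 (this ▸ hpl))
  have hv₁ : ¬ D v t₁ := foot hs hu hsl hul hsu hvu ⟨fun e => hsN (e ▸ ht₁), C₁, hC₁, hsC₁, htC₁⟩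
    (hdu t₁ ht₁ ht)
  have hv₂ : ¬ D v t₂ := foot hu hs hul hsl hsu.symm hvs
    ⟨fun e => huN (e ▸ ht₂), C₂, hC₂, huC₂, htC₂⟩ (hds t₂ ht₂ ht.symm)
  obtain ⟨k, hk, hkN, hvk⟩ : ∃ k ∈ G.lines, k ⊆ N ∧ ∀ x ∈ N, D v x → x ∈ k := by
    refine (G.pattern_or hN v).resolve_left ?_
    rintro ⟨x, hx, -, h⟩
    by_cases hx₁ : t₁ = x
    · exact hv₂ ((h t₂ ht₂).2 fun e => ht (hx₁.trans e.symm))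
    · exact hv₁ ((h t₁ ht₁).2 hx₁)
  obtain ⟨r, hr, hrk, hr₁, hr₂, -⟩ := G.exists_notMem_line_ne hN hk hkN t₁ t₂ t₂
  obtain ⟨r', hr', hrk', hr₁', hr₂', hrr'⟩ := G.exists_notMem_line_ne hN hk hkN t₁ t₂ r
  -- Points of `N` off `k` other than `t₁`, `t₂` see `s` and `u` but not `v`, so their pattern
  -- on `C` is not a line and they are `H`-adjacent to `v`.
  have hrow : ∀ x ∈ N, x ∉ k → x ≠ t₁ → x ≠ t₂ → ∃ C' ∈ H.stars, x ∈ C' ∧ v ∈ C' := by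
    intro x hx hxk hx₁ hx₂
    have hxv : ¬ D x v := fun h => hxk (hvk x hx (G.symm h))
    have hxs : D x s := G.symm (hds x hx hx₁)
    have hxu : D x u := G.symm (hdu x hx hx₂)
    rcases H.pattern hC x with h | ⟨y, hy, h', h⟩ | ⟨m, hm, hmC, h⟩
    · exact absurd hxs (h s hs)
    · have hyv : v = y := by
        by_contra hne
        exact hxv ((h v hvC).2 hne)
      exact hyv ▸ h'
    · have := H.line_unique hl hm hsu hsl hul ((h s hs).1 hxs) ((h u hu).1 hxu)
      exact absurd ((h v hvC).2 (this ▸ hvl)) hxv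
  obtain ⟨C₃, hC₃, hrC₃, hvC₃⟩ := hrow r hr hrk hr₁ hr₂
  obtain ⟨C₄, hC₄, hrC₄, hvC₄⟩ := hrow r' hr' hrk' hr₁' hr₂'
  obtain ⟨C₅, hC₅, hr₅, hv₅, hr₅'⟩ :=
    H.triangle hC₃ hC₄ hrC₃ hvC₃ hvC₄ hrC₄ (G.not_dist hN hr hr')
  have hvN : v ∈ N := star_eq_star hC₅ hN hr₅ hr₅' hr hr' hrr'.symm ▸ hv₅
  by_cases hvt : v = t₁
  · exact H.not_dist hC hu hvC (hdu v hvN fun e => ht (hvt.symm.trans e))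
  · exact H.not_dist hC hs hvC (hds v hvN hvt)

/-- Every star of `H` contains two `G`-adjacent points: a vertex `r` close to `s ∈ C` is at distance
two from a further `u ∈ C`, which produces a `G`-path of length three from `s` to `u`. -/
theorem exists_adj_of_star (hC : C ∈ H.stars) {s : V} (hs : s ∈ C) :
    ∃ x ∈ C, ∃ y ∈ C, G.Adj x y := by
  by_contra! hno
  obtain ⟨r, hsr, hr⟩ := G.exists_close s
  obtain ⟨u, hu, hus, hru⟩ : ∃ u ∈ C, u ≠ s ∧ D r u := by
    rcases H.pattern hC r with h | ⟨t, ht, -, h⟩ | ⟨l, hl, hlC, h⟩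
    · exact absurd (G.symm hsr) (h s hs)
    · obtain ⟨l, hl, hlC⟩ := H.exists_line_subset hC
      obtain ⟨u, hu, -, hus, hut, -⟩ := H.exists_notMem_line_ne hC hl hlC s t t
      exact ⟨u, hu, hus, (h u hu).2 hut⟩
    · obtain ⟨u, hul, hus, -⟩ := H.exists_third hl s s
      exact ⟨u, hlC hul, hus, (h u (hlC hul)).2 hul⟩
  obtain ⟨t₂, N, hN, C₂, hC₂, hrN, htN, htC₂, huC₂⟩ := G.exists_between hru
  obtain ⟨t₁, ht₁, C₁, hC₁, hsC₁, htC₁⟩ := hr N hN hrN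
  refine false_of_two_feet hC hN hno hs hu hus.symm (fun h => G.not_dist hN h hrN hsr)
    (fun h => G.not_dist hN hrN h hru) ht₁ htN (fun e => ?_) ⟨C₁, hC₁, hsC₁, htC₁⟩
    ⟨C₂, hC₂, huC₂, htC₂⟩
  subst e
  obtain ⟨K, hK, hsK, -, huK⟩ := G.triangle hC₁ hC₂ hsC₁ htC₁ htC₂ huC₂ (H.not_dist hC hs hu)
  exact hno s hs u hu ⟨hus.symm, K, hK, hsK, huK⟩

/-- Adjacency is determined by `D`. -/
theorem Adj.of_adj {x y : V} (h : H.Adj x y) : G.Adj x y := by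
  obtain ⟨hxy, C, hC, hx, hy⟩ := h
  obtain ⟨a, ha, b, hb, hab, M, hM, haM, hbM⟩ := exists_adj_of_star (G := G) hC hx
  exact ⟨hxy, M, hM, star_subset_star hC hM ha hb haM hbM hab hx,
    star_subset_star hC hM ha hb haM hbM hab hy⟩

end TwoGeometries

/-- The geometry obtained by transporting `G` along a permutation preserving `D`. -/
def comap (f : Equiv.Perm V) (hf : ∀ x y, D x y ↔ D (f x) (f y)) : StarGeometry D where
  stars := {C | ∃ K ∈ G.stars, C = f ⁻¹' K}
  lines := {l | ∃ m ∈ G.lines, l = f ⁻¹' m}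
  symm := G.symm
  star_unique := by
    rintro _ _ x y ⟨K, hK, rfl⟩ ⟨K', hK', rfl⟩ hxy hx hy hx' hy'
    rw [G.star_unique hK hK' (f.injective.ne hxy) hx hy hx' hy']
  not_dist := by
    rintro _ x y ⟨K, hK, rfl⟩ hx hy h
    exact G.not_dist hK hx hy ((hf x y).1 h)
  exists_line := by
    rintro _ x y ⟨K, hK, rfl⟩ hx hy hxy
    obtain ⟨l, hl, hlK, hxl, hyl⟩ := G.exists_line hK hx hy (f.injective.ne hxy)
    exact ⟨_, ⟨l, hl, rfl⟩, Set.preimage_mono hlK, hxl, hyl⟩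
  line_unique := by
    rintro _ _ x y ⟨l, hl, rfl⟩ ⟨m, hm, rfl⟩ hxy hxl hyl hxm hym
    rw [G.line_unique hl hm (f.injective.ne hxy) hxl hyl hxm hym]
  exists_third := by
    rintro _ ⟨l, hl, rfl⟩ x y
    obtain ⟨z, hz, hzx, hzy⟩ := G.exists_third hl (f x) (f y)
    obtain ⟨w, rfl⟩ := f.surjective z
    exact ⟨w, hz, fun e => hzx (e ▸ rfl), fun e => hzy (e ▸ rfl)⟩
  exists_notMem_line := by
    rintro _ _ ⟨K, hK, rfl⟩ ⟨l, hl, rfl⟩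
    obtain ⟨z, hz, hzl⟩ := G.exists_notMem_line hK hl
    obtain ⟨w, rfl⟩ := f.surjective z
    exact ⟨w, hz, hzl⟩
  exists_line_subset := by
    rintro _ ⟨K, hK, rfl⟩
    obtain ⟨l, hl, hlK⟩ := G.exists_line_subset hK
    exact ⟨_, ⟨l, hl, rfl⟩, Set.preimage_mono hlK⟩
  exists_other_star := by
    rintro _ x ⟨K, hK, rfl⟩ hx
    obtain ⟨K', hK', hx', hne⟩ := G.exists_other_star hK hx
    exact ⟨_, ⟨K', hK', rfl⟩, hx', fun e => hne (f.surjective.preimage_injective e)⟩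
  triangle := by
    rintro _ _ x y z ⟨K, hK, rfl⟩ ⟨K', hK', rfl⟩ hx hy hy' hz h
    obtain ⟨L, hL, h'⟩ := G.triangle hK hK' hx hy hy' hz fun e => h ((hf x z).2 e)
    exact ⟨_, ⟨L, hL, rfl⟩, h'⟩
  pattern := by
    rintro _ ⟨K, hK, rfl⟩ z
    rcases G.pattern hK (f z) with h | ⟨t, ht, ⟨K', hK', hz', ht'⟩, h⟩ | ⟨l, hl, hlK, h⟩
    · exact Or.inl fun x hx e => h (f x) hx ((hf z x).1 e)
    · obtain ⟨t, rfl⟩ := f.surjective t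
      refine Or.inr (Or.inl ⟨t, ht, ⟨_, ⟨K', hK', rfl⟩, hz', ht'⟩, fun x hx => ?_⟩)
      rw [hf, h (f x) hx, f.injective.ne_iff]
    · refine Or.inr (Or.inr ⟨_, ⟨l, hl, rfl⟩, Set.preimage_mono hlK, fun x hx => ?_⟩)
      rw [hf, h (f x) hx, Set.mem_preimage]
  exists_between := by
    intro x z h
    obtain ⟨y, K, hK, K', hK', h'⟩ := G.exists_between ((hf x z).1 h)
    obtain ⟨y, rfl⟩ := f.surjective y
    exact ⟨y, _, ⟨K, hK, rfl⟩, _, ⟨K', hK', rfl⟩, h'⟩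
  exists_close := by
    intro x
    obtain ⟨r, hr, h⟩ := G.exists_close (f x)
    obtain ⟨r, rfl⟩ := f.surjective r
    refine ⟨r, (hf x r).2 hr, ?_⟩
    rintro _ ⟨K, hK, rfl⟩ hrK
    obtain ⟨y, hy, K', hK', h'⟩ := h K hK hrK
    obtain ⟨y, rfl⟩ := f.surjective y
    exact ⟨y, hy, _, ⟨K', hK', rfl⟩, h'⟩

/-- A permutation preserving the relation `D` preserves adjacency: `G` and its transport along the
permutation are two geometries with the same `D`. -/
theorem adj_iff_of_dist_iff (f : Equiv.Perm V) (hf : ∀ x y, D x y ↔ D (f x) (f y)) (x y : V) :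
    G.Adj (f x) (f y) ↔ G.Adj x y := by
  have h : (G.comap f hf).Adj x y ↔ G.Adj (f x) (f y) := by
    constructor
    · rintro ⟨hxy, _, ⟨K, hK, rfl⟩, hx, hy⟩
      exact ⟨f.injective.ne hxy, K, hK, hx, hy⟩
    · rintro ⟨hxy, K, hK, hx, hy⟩
      exact ⟨fun e => hxy (e ▸ rfl), _, ⟨K, hK, rfl⟩, hx, hy⟩
  rw [← h]
  exact ⟨Adj.of_adj, Adj.of_adj⟩

end StarGeometry

namespace PolarSpace

variable {P : Type*} (G : PolarSpace P)

/-! ### Collinearity and subspaces -/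

theorem collinear_refl (p : P) : G.Collinear p p :=
  Or.inl rfl

theorem collinear_of_mem_line {l : Set P} (hl : l ∈ G.lines) {p q : P} (hp : p ∈ l) (hq : q ∈ l) :
    G.Collinear p q :=
  Or.inr ⟨l, hl, hp, hq⟩

theorem exists_line_of_collinear {p q : P} (h : G.Collinear p q) (hne : p ≠ q) :
    ∃ l ∈ G.lines, p ∈ l ∧ q ∈ l :=
  h.resolve_left hne

/-- The one-or-all axiom: a point collinear to two points of a line is collinear to all of them. -/
theorem collinear_of_two {l : Set P} (hl : l ∈ G.lines) {p a b q : P} (ha : a ∈ l) (hb : b ∈ l)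
    (hab : a ≠ b) (hpa : G.Collinear p a) (hpb : G.Collinear p b) (hq : q ∈ l) :
    G.Collinear p q := by
  rcases G.one_or_all p l hl with ⟨c, -, hc⟩ | h
  · exact absurd ((hc a ⟨ha, hpa⟩).trans (hc b ⟨hb, hpb⟩).symm) hab
  · exact h q hq

theorem exists_collinear_mem {l : Set P} (hl : l ∈ G.lines) (p : P) :
    ∃ q ∈ l, G.Collinear p q := by
  rcases G.one_or_all p l hl with ⟨c, hc, -⟩ | h
  · exact ⟨c, hc⟩
  · obtain ⟨a, ha, -⟩ := G.three_points l hl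
    exact ⟨a, ha, h a ha⟩

theorem exists_ne_of_three {α : Type*} {Q : α → Prop} {a b c : α} (ha : Q a) (hb : Q b)
    (hc : Q c) (hab : a ≠ b) (hac : a ≠ c) (hbc : b ≠ c) (x y : α) : ∃ r, Q r ∧ r ≠ x ∧ r ≠ y := by
  by_cases hax : a ≠ x ∧ a ≠ y
  · exact ⟨a, ha, hax⟩
  by_cases hbx : b ≠ x ∧ b ≠ y
  · exact ⟨b, hb, hbx⟩
  refine ⟨c, hc, ?_, ?_⟩ <;> rintro rfl <;> simp_all

theorem exists_mem_line_ne {l : Set P} (hl : l ∈ G.lines) (p q : P) : ∃ r ∈ l, r ≠ p ∧ r ≠ q := by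
  obtain ⟨a, ha, b, hb, c, hc, hab, hac, hbc⟩ := G.three_points l hl
  exact exists_ne_of_three (Q := (· ∈ l)) ha hb hc hab hac hbc p q

theorem isSubspace_perp (X : Set P) : G.IsSubspace (G.perp X) := by
  intro p hp q hq hpq l hl hpl hql r hr x hx
  exact G.collinear_symm (G.collinear_of_two hl hpl hql hpq (G.collinear_symm (hp x hx))
    (G.collinear_symm (hq x hx)) hr)

variable {G} in
theorem IsSubspace.inter' {X Y : Set P} (hX : G.IsSubspace X) (hY : G.IsSubspace Y) :
    G.IsSubspace (X ∩ Y) := fun p hp q hq hpq l hl hpl hql =>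
  Set.subset_inter (hX p hp.1 q hq.1 hpq l hl hpl hql) (hY p hp.2 q hq.2 hpq l hl hpl hql)

theorem isSingular_inter {X Y : Set P} (hX : G.IsSubspace X) (hY : G.IsSingular Y) :
    G.IsSingular (X ∩ Y) :=
  ⟨IsSubspace.inter' hX hY.1, fun p hp q hq => hY.2 p hp.2 q hq.2⟩

/-- Pairwise collinear points lie in a common maximal singular subspace: a maximal set of pairwise
collinear points is a subspace, because it is its own perp. -/
theorem exists_maximal_of_clique {K : Set P} (hK : ∀ p ∈ K, ∀ q ∈ K, G.Collinear p q) :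
    ∃ M, Maximal G.IsSingular M ∧ K ⊆ M := by
  obtain ⟨M, hKM, hM⟩ := zorn_subset_nonempty {S : Set P | ∀ p ∈ S, ∀ q ∈ S, G.Collinear p q}
    (fun c hc hchain _ => ⟨⋃₀ c, by
      rintro p ⟨S, hS, hp⟩ q ⟨T, hT, hq⟩
      rcases hchain.total hS hT with h | h
      · exact hc hT p (h hp) q hq
      · exact hc hS p hp q (h hq), fun S hS => Set.subset_sUnion_of_mem hS⟩) K hK
  have hperp : G.perp M ⊆ M := by
    intro p hp
    have hins : insert p M ∈ {S : Set P | ∀ p ∈ S, ∀ q ∈ S, G.Collinear p q} := by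
      rintro a (rfl | ha) b (rfl | hb)
      · exact G.collinear_refl _
      · exact hp b hb
      · exact G.collinear_symm (hp a ha)
      · exact hM.prop a ha b hb
    exact hM.le_of_ge hins (Set.subset_insert p M) (Set.mem_insert p M)
  have heq : G.perp M = M := hperp.antisymm fun p hp q hq => hM.prop p hp q hq
  refine ⟨M, ⟨⟨heq ▸ G.isSubspace_perp M, hM.prop⟩, fun S hS hle => ?_⟩, hKM⟩
  exact hM.le_of_ge hS.2 hle

/-! ### Hyperplanes -/

/-- `X` is a geometric hyperplane of `Y`: a proper subset meeting every line contained in `Y`. -/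
def IsHyperplane (X Y : Set P) : Prop :=
  X ⊆ Y ∧ X ≠ Y ∧ ∀ l ∈ G.lines, l ⊆ Y → (l ∩ X).Nonempty

variable {G} in
theorem IsHyperplane.inter {X Y Z : Set P} (h : G.IsHyperplane X Y) (hZY : Z ⊆ Y)
    (hZX : ¬ Z ⊆ X) : G.IsHyperplane (X ∩ Z) Z := by
  refine ⟨Set.inter_subset_right, fun e => hZX (Set.inter_eq_right.1 e), fun l hl hlZ => ?_⟩
  obtain ⟨p, hpl, hpX⟩ := h.2.2 l hl (hlZ.trans hZY)
  exact ⟨p, hpl, hpX, hlZ hpl⟩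

variable {G} in
/-- A hyperplane of a singular subspace is a maximal proper subspace. -/
theorem IsHyperplane.subset_of_mem {X Y Z : Set P} (h : G.IsHyperplane X Y) (hY : G.IsSingular Y)
    (hZ : G.IsSubspace Z) (hXZ : X ⊆ Z) {p : P} (hpY : p ∈ Y) (hpZ : p ∈ Z) (hpX : p ∉ X) :
    Y ⊆ Z := by
  intro q hq
  by_cases hpq : p = q
  · exact hpq ▸ hpZ
  obtain ⟨l, hl, hpl, hql⟩ := G.exists_line_of_collinear (hY.2 p hpY q hq) hpq
  obtain ⟨r, hrl, hrX⟩ := h.2.2 l hl (hY.1 p hpY q hq hpq l hl hpl hql)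
  exact hZ p hpZ r (hXZ hrX) (fun e => hpX (e ▸ hrX)) l hl hpl hrl hql

variable {G} in
theorem IsHyperplane.eq_of_subset {X Y Z : Set P} (h : G.IsHyperplane X Y) (hY : G.IsSingular Y)
    (hZ : G.IsSubspace Z) (hXZ : X ⊆ Z) (hZY : Z ⊆ Y) (hne : Z ≠ Y) : Z = X := by
  refine Set.Subset.antisymm (fun p hp => ?_) hXZ
  by_contra hpX
  exact hne (hZY.antisymm (h.subset_of_mem hY hZ hXZ (hZY hp) hp hpX))

theorem isHyperplane_perp {M : Set P} {x m : P} (hm : m ∈ M)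
    (hxm : ¬ G.Collinear m x) : G.IsHyperplane (G.perp {x} ∩ M) M := by
  refine ⟨Set.inter_subset_right, fun e => ?_, fun l hl hlM => ?_⟩
  · exact hxm ((Set.inter_eq_right.1 e hm) x rfl)
  · obtain ⟨q, hq, hxq⟩ := G.exists_collinear_mem hl x
    refine ⟨q, hq, ?_, hlM hq⟩
    rintro y rfl
    exact G.collinear_symm hxq

/-! ### Adjoining a point to a singular subspace -/

/-- `X` is determined by its perp: every point of `X^⊥` collinear to all of `X^⊥` lies in `X`. -/
def PerpClosed (X : Set P) : Prop :=
  ∀ z ∈ G.perp X, (∀ y ∈ G.perp X, G.Collinear y z) → z ∈ X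

/-- The join of `X` and a point `p`, as the set of points of `(X ∪ {p})^⊥` that are collinear to
all of `(X ∪ {p})^⊥`. -/
def adjoin (X : Set P) (p : P) : Set P :=
  {z | z ∈ G.perp (insert p X) ∧ ∀ y ∈ G.perp (insert p X), G.Collinear y z}

variable {G} {X Y : Set P} {p : P}

theorem mem_perp_insert {y : P} :
    y ∈ G.perp (insert p X) ↔ G.Collinear y p ∧ y ∈ G.perp X :=
  Set.forall_mem_insert ..

theorem insert_subset_adjoin (hX : G.IsSingular X) (hp : p ∈ G.perp X) :
    insert p X ⊆ G.adjoin X p := by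
  intro z hz
  refine ⟨?_, fun y hy => hy z hz⟩
  rcases hz with rfl | hz
  · exact mem_perp_insert.2 ⟨G.collinear_refl z, hp⟩
  · exact mem_perp_insert.2 ⟨G.collinear_symm (hp z hz), hX.2 z hz⟩

theorem isSingular_adjoin : G.IsSingular (G.adjoin X p) := by
  refine ⟨fun a ha b hb hab l hl hal hbl c hc => ⟨?_, fun y hy => ?_⟩, fun a ha b hb => hb.2 a ha.1⟩
  · exact G.isSubspace_perp _ a ha.1 b hb.1 hab l hl hal hbl hc
  · exact G.collinear_of_two hl hal hbl hab (ha.2 y hy) (hb.2 y hy) hc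

/-- In the join of a closed singular subspace `X` and a point, every line meets `X`. Here the point
of the line `l` lying in `X` is found as the one collinear to some `x ∈ X^⊥` not collinear
to `p`. -/
theorem isHyperplane_adjoin (hX : G.IsSingular X) (hc : G.PerpClosed X) (hp : p ∈ G.perp X)
    (hpX : p ∉ X) : G.IsHyperplane X (G.adjoin X p) := by
  have hsub := insert_subset_adjoin hX hp
  refine ⟨(Set.subset_insert p X).trans hsub, fun e => ?_, fun l hl hlJ => ?_⟩
  · exact hpX (e ▸ hsub (Set.mem_insert p X))
  obtain ⟨x, hx, hxp⟩ : ∃ x ∈ G.perp X, ¬ G.Collinear x p := by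
    by_contra! h
    exact hpX (hc p hp h)
  obtain ⟨z, hzl, hxz⟩ := G.exists_collinear_mem hl x
  refine ⟨z, hzl, ?_⟩
  by_contra hzX
  have hz := hlJ hzl
  obtain ⟨hzp, hzX'⟩ := mem_perp_insert.1 hz.1
  obtain ⟨y, hy, hyz⟩ : ∃ y ∈ G.perp X, ¬ G.Collinear y z := by
    by_contra! h
    exact hzX (hc z hzX' h)
  -- Moving `x` along the line `xz` makes it collinear to `y`.
  obtain ⟨u, hu, huz, hup, hyu⟩ : ∃ u ∈ G.perp X, G.Collinear u z ∧ ¬ G.Collinear u p ∧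
      G.Collinear y u := by
    by_cases hyx : G.Collinear y x
    · exact ⟨x, hx, hxz, hxp, hyx⟩
    have hxz' : x ≠ z := fun e => hxp (e ▸ hzp)
    obtain ⟨k, hk, hxk, hzk⟩ := G.exists_line_of_collinear hxz hxz'
    obtain ⟨u, huk, hyu⟩ := G.exists_collinear_mem hk y
    have huz : u ≠ z := fun e => hyz (e ▸ hyu)
    refine ⟨u, G.isSubspace_perp X x hx z hzX' hxz' k hk hxk hzk huk,
      G.collinear_of_mem_line hk huk hzk, fun hup => hxp ?_, hyu⟩
    exact G.collinear_symm (G.collinear_of_two hk huk hzk huz (G.collinear_symm hup)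
      (G.collinear_symm hzp) hxk)
  have hyu' : y ≠ u := fun e => hyz (e ▸ huz)
  obtain ⟨k, hk, hyk, huk⟩ := G.exists_line_of_collinear hyu hyu'
  obtain ⟨w, hwk, hpw⟩ := G.exists_collinear_mem hk p
  have hw : w ∈ G.perp X := G.isSubspace_perp X y hy u hu hyu' k hk hyk huk hwk
  have hwz : G.Collinear w z := hz.2 w (mem_perp_insert.2 ⟨G.collinear_symm hpw, hw⟩)
  have hwu : w ≠ u := fun e => hup (e ▸ G.collinear_symm hpw)
  exact hyz (G.collinear_symm (G.collinear_of_two hk hwk huk hwu (G.collinear_symm hwz)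
    (G.collinear_symm huz) hyk))

theorem perpClosed_adjoin (hX : G.IsSingular X) (hp : p ∈ G.perp X) :
    G.PerpClosed (G.adjoin X p) := by
  have hperp : G.perp (insert p X) = G.perp (G.adjoin X p) :=
    Set.Subset.antisymm (fun y hy z hz => hz.2 y hy)
      fun y hy z hz => hy z (insert_subset_adjoin hX hp hz)
  intro z hz h
  rw [← hperp] at hz h
  exact ⟨hz, h⟩

theorem perpClosed_empty : G.PerpClosed ∅ := by
  intro z _ h
  exact absurd ⟨z, fun q => G.collinear_symm (h q fun x hx => hx.elim)⟩ G.no_radical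

theorem isSingular_empty : G.IsSingular ∅ :=
  ⟨fun _ hp => hp.elim, fun _ hp => hp.elim⟩

theorem adjoin_subset (hX : G.IsSingular X) (hc : G.PerpClosed X) (hp : p ∈ G.perp X) (hpX : p ∉ X)
    (hY : G.IsSubspace Y) (hXY : X ⊆ Y) (hpY : p ∈ Y) : G.adjoin X p ⊆ Y :=
  (isHyperplane_adjoin hX hc hp hpX).subset_of_mem isSingular_adjoin hY hXY
    (insert_subset_adjoin hX hp (Set.mem_insert p X)) hpY hpX

/-! ### Heights of singular subspaces -/

variable (G) in
/-- `S` is a singular subspace of height `m` in the poset of singular subspaces, that is, of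
projective dimension `m - 1`. -/
def HasHeight (S : Set P) (m : ℕ) : Prop :=
  ∃ h : G.IsSingular S, Order.height (⟨S, h⟩ : G.SingularSubspace) = (m : ℕ∞)

theorem hasProjDim_iff {S : Set P} {d : ℤ} {m : ℕ} (hd : d = (m : ℤ) - 1) :
    G.HasProjDim S d ↔ G.HasHeight S m := by
  constructor
  · rintro ⟨h, m', hm', hmd⟩
    obtain rfl : m' = m := by omega
    exact ⟨h, hm'⟩
  · rintro ⟨h, hm⟩
    exact ⟨h, m, hm, by omega⟩

theorem HasHeight.exists_of_subset {m : ℕ} (hY : G.HasHeight Y m) (hX : G.IsSingular X)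
    (h : X ⊆ Y) : ∃ j ≤ m, G.HasHeight X j := by
  obtain ⟨hY', hm⟩ := hY
  have hle : Order.height (⟨X, hX⟩ : G.SingularSubspace) ≤ m :=
    hm ▸ Order.height_mono (show (⟨X, hX⟩ : G.SingularSubspace) ≤ ⟨Y, hY'⟩ from h)
  obtain ⟨j, hj⟩ := ENat.ne_top_iff_exists.1 (ne_top_of_le_ne_top (ENat.natCast_ne_top m) hle)
  rw [← hj] at hle
  exact ⟨j, by exact_mod_cast hle, hX, hj.symm⟩

theorem HasHeight.lt_of_ssubset {i j : ℕ} (hX : G.HasHeight X i) (hY : G.HasHeight Y j)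
    (h : X ⊂ Y) : i < j := by
  obtain ⟨hX', hi⟩ := hX
  obtain ⟨hY', hj⟩ := hY
  have := Order.height_strictMono (show (⟨X, hX'⟩ : G.SingularSubspace) < ⟨Y, hY'⟩ from h)
    (by rw [hi]; exact ENat.natCast_lt_top i)
  rw [hi, hj] at this
  exact_mod_cast this

theorem HasHeight.eq_of_subset {i j : ℕ} (hX : G.HasHeight X i) (hY : G.HasHeight Y j)
    (h : X ⊆ Y) (hji : j ≤ i) : X = Y := by
  by_contra hne
  have := hX.lt_of_ssubset hY (h.ssubset_of_ne hne)
  omega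

theorem HasHeight.unique {i j : ℕ} (hX : G.HasHeight X i) (hX' : G.HasHeight X j) : i = j := by
  obtain ⟨_, hi⟩ := hX
  obtain ⟨_, hj⟩ := hX'
  rw [hi] at hj
  exact_mod_cast hj

/-- Passing from a singular subspace to a hyperplane lowers the height by exactly one: any proper
subspace `Z` of `Y` not inside the hyperplane `X` has the smaller hyperplane `X ∩ Z ⊂ X`. -/
theorem IsHyperplane.height_eq {i j : ℕ} (h : G.IsHyperplane X Y) (hX : G.HasHeight X i)
    (hY : G.HasHeight Y j) : j = i + 1 := by
  induction j using Nat.strong_induction_on generalizing X Y i with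
  | _ j ih =>
    have hlt := hX.lt_of_ssubset hY (h.1.ssubset_of_ne h.2.1)
    suffices j ≤ i + 1 by omega
    obtain ⟨hY', hj⟩ := hY
    suffices hle : Order.height (⟨Y, hY'⟩ : G.SingularSubspace) ≤ ((i + 1 : ℕ) : ℕ∞) by
      rw [hj] at hle
      exact_mod_cast hle
    rw [Order.height_le_coe_iff]
    rintro ⟨Z, hZ⟩ hZY
    have hZY' : Z ⊂ Y := hZY
    obtain ⟨c, -, hc⟩ := HasHeight.exists_of_subset ⟨hY', hj⟩ hZ hZY'.1
    have hcj := hc.lt_of_ssubset ⟨hY', hj⟩ hZY'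
    suffices c < i + 1 by
      obtain ⟨_, hc'⟩ := hc
      rw [hc']
      exact_mod_cast this
    by_cases hZX : Z ⊆ X
    · obtain ⟨c', hc', hcc⟩ := hX.exists_of_subset hZ hZX
      have := hc.unique hcc
      omega
    obtain ⟨a, -, ha⟩ := hX.exists_of_subset (G.isSingular_inter hX.1.1 hZ) Set.inter_subset_left
    have hca := ih c hcj (h.inter hZY'.1 hZX) ha hc
    have hXZ : X ∩ Z ⊂ X := by
      refine Set.inter_subset_left.ssubset_of_ne fun e => hZX ?_
      exact (h.eq_of_subset hY' hZ.1 (Set.inter_eq_left.1 e) hZY'.1 hZY'.ne).subset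
    have := ha.lt_of_ssubset hX hXZ
    omega

theorem IsHyperplane.hasHeight_left {j : ℕ} (h : G.IsHyperplane X Y) (hX : G.IsSingular X)
    (hY : G.HasHeight Y (j + 1)) : G.HasHeight X j := by
  obtain ⟨i, -, hi⟩ := hY.exists_of_subset hX h.1
  have := h.height_eq hi hY
  obtain rfl : j = i := by omega
  exact hi

/-- Singular subspaces of finite height are closed: they are exhausted by adjoining points to the
empty set. -/
theorem HasHeight.perpClosed {m : ℕ} (hY : G.HasHeight Y m) : G.PerpClosed Y := by
  by_contra hc
  have key : ∀ j : ℕ, ∃ X, ∃ i ≥ j, X ⊆ Y ∧ G.PerpClosed X ∧ G.HasHeight X i := by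
    intro j
    induction j with
    | zero =>
      obtain ⟨i, -, hi⟩ := hY.exists_of_subset isSingular_empty (Set.empty_subset Y)
      exact ⟨∅, i, Nat.zero_le i, Set.empty_subset Y, perpClosed_empty, hi⟩
    | succ j ih =>
      obtain ⟨X, i, hij, hXY, hcX, hX⟩ := ih
      obtain ⟨p, hpY, hpX⟩ : ∃ p ∈ Y, p ∉ X := by
        by_contra! h
        exact hc (hXY.antisymm h ▸ hcX)
      have hp : p ∈ G.perp X := fun x hx => hY.1.2 p hpY x (hXY hx)
      have hJY := adjoin_subset hX.1 hcX hp hpX hY.1.1 hXY hpY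
      obtain ⟨c, -, hJ⟩ := hY.exists_of_subset isSingular_adjoin hJY
      have := (isHyperplane_adjoin hX.1 hcX hp hpX).height_eq hX hJ
      exact ⟨_, c, by omega, hJY, perpClosed_adjoin hX.1 hp, hJ⟩
  obtain ⟨X, i, hi, hXY, -, hX⟩ := key (m + 1)
  obtain ⟨c, hc', hX'⟩ := hY.exists_of_subset hX.1 hXY
  have := hX.unique hX'
  omega

theorem HasHeight.isHyperplane_of_subset {i : ℕ} (hX : G.HasHeight X i)
    (hY : G.HasHeight Y (i + 1)) (h : X ⊆ Y) : G.IsHyperplane X Y := by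
  obtain ⟨p, hpY, hpX⟩ : ∃ p ∈ Y, p ∉ X := by
    by_contra! h'
    have := hX.unique (h.antisymm h' ▸ hY)
    omega
  have hp : p ∈ G.perp X := fun x hx => hY.1.2 p hpY x (h hx)
  have hH := isHyperplane_adjoin hX.1 hX.perpClosed hp hpX
  have hJY := adjoin_subset hX.1 hX.perpClosed hp hpX hY.1.1 h hpY
  obtain ⟨c, -, hJ⟩ := hY.exists_of_subset isSingular_adjoin hJY
  have hc := hH.height_eq hX hJ
  exact hJ.eq_of_subset hY hJY hc.ge ▸ hH

theorem exists_not_collinear (hX : G.PerpClosed X) (hp : p ∈ G.perp X) (hpX : p ∉ X) :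
    ∃ y ∈ G.perp X, ¬ G.Collinear y p := by
  by_contra! h
  exact hpX (hX p hp h)

end PolarSpace

namespace PolarSpace

variable {P : Type*} {G : PolarSpace P} {X Y S : Set P} {p : P}

/-! ### Subspaces of prescribed height -/

theorem HasHeight.nonempty {m : ℕ} (hS : G.HasHeight S m) (hm : 1 ≤ m) : S.Nonempty := by
  rw [Set.nonempty_iff_ne_empty]
  rintro rfl
  obtain ⟨h, hm'⟩ := hS
  have : Order.height (⟨∅, h⟩ : G.SingularSubspace) = 0 :=
    Order.height_eq_zero.2 fun T _ => Set.empty_subset T.1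
  rw [hm'] at this
  have : m = 0 := by exact_mod_cast this
  omega

theorem HasHeight.exists_hyperplane {m : ℕ} (hS : G.HasHeight S (m + 1)) (hp : p ∈ S) :
    ∃ A, G.HasHeight A m ∧ A ⊆ S ∧ p ∉ A := by
  obtain ⟨x, hx⟩ : ∃ x, ¬ G.Collinear p x := by
    by_contra! h
    exact G.no_radical ⟨p, h⟩
  exact ⟨_, (G.isHyperplane_perp hp hx).hasHeight_left
    (G.isSingular_inter (G.isSubspace_perp _) hS.1) hS, Set.inter_subset_right,
    fun h => hx (h.1 x rfl)⟩

theorem HasHeight.exists_join {m : ℕ} (hX : G.HasHeight X m) (hY : G.HasHeight Y (m + 2))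
    (hXY : X ⊆ Y) (hpY : p ∈ Y) (hpX : p ∉ X) :
    ∃ Z, G.HasHeight Z (m + 1) ∧ X ⊆ Z ∧ p ∈ Z ∧ Z ⊆ Y := by
  have hp : p ∈ G.perp X := fun x hx => hY.1.2 p hpY x (hXY hx)
  have hH := isHyperplane_adjoin hX.1 hX.perpClosed hp hpX
  have hJY := PolarSpace.adjoin_subset hX.1 hX.perpClosed hp hpX hY.1.1 hXY hpY
  obtain ⟨c, -, hJ⟩ := hY.exists_of_subset isSingular_adjoin hJY
  obtain rfl := hH.height_eq hX hJ
  exact ⟨_, hJ, hH.1, insert_subset_adjoin hX.1 hp (Set.mem_insert p X), hJY⟩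

theorem HasHeight.inter {m : ℕ} {M : Set P} (hX : G.HasHeight X (m + 1))
    (hY : G.HasHeight Y (m + 1)) (hM : G.HasHeight M (m + 2)) (hXM : X ⊆ M) (hYM : Y ⊆ M)
    (hne : X ≠ Y) : G.HasHeight (X ∩ Y) m := by
  have h := (hX.isHyperplane_of_subset hM hXM).inter hYM
    fun h => hne (hY.eq_of_subset hX h le_rfl).symm
  exact h.hasHeight_left (G.isSingular_inter hX.1.1 hY.1) hY

/-! ### The stars of the polar Grassmann graph -/

section Rank

variable {k : ℕ} {d : ℤ}

theorem vertex_height (hd : d = k) (X : G.Grassmannian d) : G.HasHeight X.1 (k + 1) :=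
  (hasProjDim_iff (by push_cast; omega)).1 X.2

theorem exists_vertex (hd : d = k) (hX : G.HasHeight X (k + 1)) :
    ∃ x : G.Grassmannian d, x.1 = X :=
  ⟨⟨X, (hasProjDim_iff (by push_cast; omega)).2 hX⟩, rfl⟩

theorem grassmannGraph_dist_eq_two {x y z : G.Grassmannian d} (hxy : (G.grassmannGraph d).Adj x y)
    (hyz : (G.grassmannGraph d).Adj y z) (hxz : x ≠ z) (h : ¬ (G.grassmannGraph d).Adj x z) :
    (G.grassmannGraph d).dist x z = 2 := by
  have hle : (G.grassmannGraph d).dist x z ≤ 2 :=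
    SimpleGraph.dist_le (SimpleGraph.Walk.cons hxy (SimpleGraph.Walk.cons hyz .nil))
  have hpos := (hxy.reachable.trans hyz.reachable).pos_dist_of_ne hxz
  have h1 : (G.grassmannGraph d).dist x z ≠ 1 := fun e => h (SimpleGraph.dist_eq_one_iff_adj.1 e)
  omega

theorem exists_adj_adj_of_dist {x z : G.Grassmannian d} (h : (G.grassmannGraph d).dist x z = 2) :
    ∃ y, (G.grassmannGraph d).Adj x y ∧ (G.grassmannGraph d).Adj y z := by
  obtain ⟨w, hw⟩ := SimpleGraph.exists_walk_of_dist_ne_zero (G := G.grassmannGraph d)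
    (u := x) (v := z) (by omega)
  rw [h] at hw
  cases w with
  | nil => simp at hw
  | cons hxy w =>
    cases w with
    | nil => simp at hw
    | cons hyz w =>
      cases w with
      | nil => exact ⟨_, hxy, hyz⟩
      | cons _ w => simp at hw

theorem subset_perp_of_adj {x y : G.Grassmannian d} (h : (G.grassmannGraph d).Adj x y) :
    y.1 ⊆ G.perp x.1 := by
  have h1 := h.1
  rw [sub_zero] at h1
  exact Set.inter_eq_right.1 (G.eq_of_hasProjDim h1 y.2 Set.inter_subset_right)

variable (hrank : ∀ M, Maximal G.IsSingular M → G.HasHeight M (k + 2)) (hd : d = k)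

theorem exists_maximal_of_perp {x y z : Set P} (hx : G.IsSingular x) (hy : G.IsSingular y)
    (hz : G.IsSingular z) (hxy : y ⊆ G.perp x) (hyz : z ⊆ G.perp y) (hxz : z ⊆ G.perp x) :
    ∃ M, Maximal G.IsSingular M ∧ x ⊆ M ∧ y ⊆ M ∧ z ⊆ M := by
  obtain ⟨M, hM, h⟩ := G.exists_maximal_of_clique (K := x ∪ y ∪ z) (by
    rintro a ((ha | ha) | ha) b ((hb | hb) | hb)
    · exact hx.2 a ha b hb
    · exact G.collinear_symm (hxy hb a ha)
    · exact G.collinear_symm (hxz hb a ha)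
    · exact hxy ha b hb
    · exact hy.2 a ha b hb
    · exact G.collinear_symm (hyz hb a ha)
    · exact hxz ha b hb
    · exact hyz ha b hb
    · exact hz.2 a ha b hb)
  exact ⟨M, hM, fun a ha => h (Or.inl (Or.inl ha)), fun a ha => h (Or.inl (Or.inr ha)),
    fun a ha => h (Or.inr ha)⟩

theorem subset_perp {M : Set P} (hM : G.IsSingular M) (hX : X ⊆ M) (hY : Y ⊆ M) :
    Y ⊆ G.perp X := fun p hp q hq => hM.2 p (hY hp) q (hX hq)

include hrank in
theorem exists_height (hX : G.IsSingular X) : ∃ m, G.HasHeight X m := by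
  obtain ⟨M, hM, hXM⟩ := G.exists_maximal_of_clique hX.2
  obtain ⟨m, -, hm⟩ := (hrank M hM).exists_of_subset hX hXM
  exact ⟨m, hm⟩

include hrank hd in
theorem grassmannGraph_adj_iff {x y : G.Grassmannian d} :
    (G.grassmannGraph d).Adj x y ↔ x ≠ y ∧ ∃ M, Maximal G.IsSingular M ∧ x.1 ⊆ M ∧ y.1 ⊆ M := by
  have hx := vertex_height hd x
  have hy := vertex_height hd y
  constructor
  · intro h
    have hxy := subset_perp_of_adj h
    obtain ⟨M, hM, hxM, hyM, -⟩ := exists_maximal_of_perp hx.1 hy.1 hy.1 hxy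
      (fun p hp q hq => hy.1.2 p hp q hq) hxy
    exact ⟨h.ne, M, hM, hxM, hyM⟩
  · rintro ⟨hne, M, hM, hxM, hyM⟩
    refine ⟨?_, (hasProjDim_iff (by omega)).2 (hx.inter hy (hrank M hM) hxM hyM
      fun e => hne (Subtype.ext e))⟩
    rw [Set.inter_eq_right.2 (subset_perp hM.prop hxM hyM), sub_zero]
    exact y.2

include hrank hd in
/-- If `x^⊥` meets `z` in a hyperplane, then every maximal singular subspace through `x` and this
hyperplane contains a common neighbour of `x` and `z`. -/
theorem exists_common_neighbor {x z : G.Grassmannian d}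
    (h : G.IsHyperplane (G.perp x.1 ∩ z.1) z.1) {N : Set P} (hN : Maximal G.IsSingular N)
    (hxN : x.1 ⊆ N) (hzN : G.perp x.1 ∩ z.1 ⊆ N) :
    ∃ y : G.Grassmannian d, y.1 ⊆ N ∧ (G.grassmannGraph d).Adj x y ∧
      (G.grassmannGraph d).Adj y z := by
  have hx := vertex_height hd x
  have hz := vertex_height hd z
  obtain ⟨p, hpz, hpx⟩ : ∃ p ∈ z.1, p ∉ G.perp x.1 := by
    by_contra! h'
    exact h.2.1 (Set.inter_eq_right.2 h')
  obtain ⟨q, hqx, hpq⟩ : ∃ q ∈ x.1, ¬ G.Collinear p q := by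
    by_contra! h'
    exact hpx h'
  have hH : G.IsHyperplane (G.perp {p} ∩ N) N :=
    G.isHyperplane_perp (hxN hqx) fun h' => hpq (G.collinear_symm h')
  obtain ⟨y, hy⟩ := exists_vertex hd (hH.hasHeight_left
    (G.isSingular_inter (G.isSubspace_perp _) hN.prop) (hrank N hN))
  have hyN : y.1 ⊆ N := hy ▸ Set.inter_subset_right
  have hyp : y.1 ⊆ G.perp {p} := hy ▸ Set.inter_subset_left
  have hyz : z.1 ⊆ G.perp y.1 := by
    intro a ha r hr
    have hsub : z.1 ⊆ G.perp {r} := by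
      refine h.subset_of_mem hz.1 (G.isSubspace_perp {r}) ?_ hpz ?_ fun h' => hpx h'.1
      · rintro b hb _ rfl
        exact hN.prop.2 b (hzN hb) _ (hyN hr)
      · rintro _ rfl
        exact G.collinear_symm (hyp hr p rfl)
    exact hsub ha r rfl
  obtain ⟨M, hM, hyM, hzM, -⟩ := exists_maximal_of_perp (vertex_height hd y).1 hz.1 hz.1 hyz
    (fun p hp q hq => hz.1.2 p hp q hq) hyz
  refine ⟨y, hyN, (grassmannGraph_adj_iff hrank hd).2 ⟨fun e => ?_, N, hN, hxN, hyN⟩,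
    (grassmannGraph_adj_iff hrank hd).2 ⟨fun e => ?_, M, hM, hyM, hzM⟩⟩
  · exact hpq (G.collinear_symm (hyp (e ▸ hqx) p rfl))
  · exact hpq (hN.prop.2 p (hyN (e ▸ hpz)) q (hxN hqx))

include hrank hd in
/-- Vertices `x`, `z` are at distance two if and only if `x^⊥ ∩ z` is a hyperplane of `z`. -/
theorem dist_eq_two_iff {x z : G.Grassmannian d} :
    (G.grassmannGraph d).dist x z = 2 ↔ G.IsHyperplane (G.perp x.1 ∩ z.1) z.1 := by
  have hx := vertex_height hd x
  have hz := vertex_height hd z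
  constructor
  · intro h
    obtain ⟨y, hxy, hyz⟩ := exists_adj_adj_of_dist h
    have hyz' : G.HasHeight (y.1 ∩ z.1) k := (hasProjDim_iff (by omega)).1 hyz.2
    have hH := hyz'.isHyperplane_of_subset hz Set.inter_subset_right
    have hsub : y.1 ∩ z.1 ⊆ G.perp x.1 ∩ z.1 :=
      Set.inter_subset_inter_left _ (subset_perp_of_adj hxy)
    have hne : G.perp x.1 ∩ z.1 ≠ z.1 := by
      intro e
      have hxz := Set.inter_eq_right.1 e
      by_cases hxz' : x = z
      · subst hxz'
        simp at h
      obtain ⟨M, hM, hxM, hzM, -⟩ := exists_maximal_of_perp hx.1 hz.1 hz.1 hxz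
        (fun p hp q hq => hz.1.2 p hp q hq) hxz
      have := SimpleGraph.dist_eq_one_iff_adj.2
        ((grassmannGraph_adj_iff hrank hd).2 ⟨hxz', M, hM, hxM, hzM⟩)
      omega
    rw [hH.eq_of_subset hz.1 (G.isSingular_inter (G.isSubspace_perp _) hz.1).1 hsub
      Set.inter_subset_right hne]
    exact hH
  · intro h
    obtain ⟨N, hN, hxN, hzN, -⟩ := exists_maximal_of_perp hx.1
      (G.isSingular_inter (G.isSubspace_perp x.1) hz.1)
      (G.isSingular_inter (G.isSubspace_perp x.1) hz.1) Set.inter_subset_left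
      (fun p hp q hq => hz.1.2 p hp.2 q hq.2) Set.inter_subset_left
    obtain ⟨y, -, hxy, hyz⟩ := exists_common_neighbor hrank hd h hN hxN hzN
    have hnot : ¬ z.1 ⊆ G.perp x.1 := fun h' => h.2.1 (Set.inter_eq_right.2 h')
    refine grassmannGraph_dist_eq_two hxy hyz (fun e => ?_) fun h' => hnot (subset_perp_of_adj h')
    exact hnot (e ▸ fun p hp q hq => hx.1.2 p hp q hq)

include hrank hd in
/-- Two distinct vertices lie in at most one common maximal singular subspace. -/
theorem maximal_eq_of_two {M M' : Set P} (hM : Maximal G.IsSingular M)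
    (hM' : Maximal G.IsSingular M') {x y : G.Grassmannian d} (hxy : x ≠ y) (hx : x.1 ⊆ M)
    (hy : y.1 ⊆ M) (hx' : x.1 ⊆ M') (hy' : y.1 ⊆ M') : M = M' := by
  have hxh := vertex_height hd x
  have hyh := vertex_height hd y
  obtain ⟨p, hpy, hpx⟩ : ∃ p ∈ y.1, p ∉ x.1 := by
    by_contra! h
    exact hxy (Subtype.ext (hyh.eq_of_subset hxh h le_rfl).symm)
  have hsub := (hxh.isHyperplane_of_subset (hrank M hM) hx).subset_of_mem hM.prop hM'.prop.1 hx'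
    (hy hpy) (hy' hpy) hpx
  exact hM.eq_of_subset hM'.prop hsub

include hrank in
/-- The pencil of hyperplanes of `M` through a subspace `A` of codimension two has at least three
members: two members contain points `p` and `q`, and a third one a further point of the line
`pq`. -/
theorem exists_pencil_third {M A : Set P} (hM : Maximal G.IsSingular M)
    (hA : G.HasHeight A k) (hAM : A ⊆ M) (x y : Set P) :
    ∃ z, G.HasHeight z (k + 1) ∧ A ⊆ z ∧ z ⊆ M ∧ z ≠ x ∧ z ≠ y := by
  have hMh := hrank M hM
  obtain ⟨p, hpM, hpA⟩ : ∃ p ∈ M, p ∉ A := by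
    by_contra! h
    have := hA.unique (hAM.antisymm h ▸ hMh)
    omega
  obtain ⟨W, hW, hAW, hpW, hWM⟩ := hA.exists_join hMh hAM hpM hpA
  obtain ⟨q, hqM, hqW⟩ : ∃ q ∈ M, q ∉ W := by
    by_contra! h
    have := hW.unique (hWM.antisymm h ▸ hMh)
    omega
  obtain ⟨U, hU, hAU, hqU, hUM⟩ := hA.exists_join hMh hAM hqM fun h => hqW (hAW h)
  have hpU : p ∉ U := by
    intro hpU
    have hWU : W = U := by
      refine hW.eq_of_subset hU ?_ le_rfl
      exact (hA.isHyperplane_of_subset hW hAW).subset_of_mem hW.1 hU.1.1 hAU hpW hpU hpA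
    exact hqW (hWU ▸ hqU)
  have hpq : p ≠ q := fun e => hqW (e ▸ hpW)
  obtain ⟨l, hl, hpl, hql⟩ := G.exists_line_of_collinear (hM.prop.2 p hpM q hqM) hpq
  obtain ⟨r, hrl, hrp, hrq⟩ := G.exists_mem_line_ne hl p q
  have hrM : r ∈ M := hM.prop.1 p hpM q hqM hpq l hl hpl hql hrl
  have hrW : r ∉ W := fun h => hqW (hW.1.1 r h p hpW hrp l hl hrl hpl hql)
  have hrU : r ∉ U := fun h => hpU (hU.1.1 r h q hqU hrq l hl hrl hql hpl)
  obtain ⟨T, hT, hAT, hrT, hTM⟩ := hA.exists_join hMh hAM hrM fun h => hrW (hAW h)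
  have hWU : W ≠ U := fun e => hqW (e ▸ hqU)
  have hWT : W ≠ T := fun e => hrW (e ▸ hrT)
  have hUT : U ≠ T := fun e => hrU (e ▸ hrT)
  obtain ⟨Z, ⟨hZ, hAZ, hZM⟩, hZxy⟩ := exists_ne_of_three
    (Q := fun Z => G.HasHeight Z (k + 1) ∧ A ⊆ Z ∧ Z ⊆ M) ⟨hW, hAW, hWM⟩ ⟨hU, hAU, hUM⟩
    ⟨hT, hAT, hTM⟩ hWU hWT hUT x y
  exact ⟨Z, hZ, hAZ, hZM, hZxy⟩

include hrank hd in
/-- Vertices at distance two from `z` inside a maximal singular subspace `M` are governed by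
`B = z^⊥ ∩ M`: if `B` has codimension one they are the vertices different from `B`, if `B` has
codimension two they are the vertices containing `B`, and otherwise there are none. -/
theorem star_pattern {M : Set P} (hM : Maximal G.IsSingular M) (z : G.Grassmannian d) :
    (∀ x : G.Grassmannian d, x.1 ⊆ M → ¬ (G.grassmannGraph d).dist z x = 2) ∨
    (∃ t : G.Grassmannian d, t.1 ⊆ M ∧ t.1 ⊆ G.perp z.1 ∧
      ∀ x : G.Grassmannian d, x.1 ⊆ M → ((G.grassmannGraph d).dist z x = 2 ↔ x ≠ t)) ∨
    ∃ A, G.HasHeight A k ∧ A ⊆ M ∧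
      ∀ x : G.Grassmannian d, x.1 ⊆ M → ((G.grassmannGraph d).dist z x = 2 ↔ A ⊆ x.1) := by
  by_cases hall : ∀ x : G.Grassmannian d, x.1 ⊆ M → ¬ (G.grassmannGraph d).dist z x = 2
  · exact Or.inl hall
  right
  push Not at hall
  obtain ⟨x₀, hx₀M, hx₀⟩ := hall
  have hMh := hrank M hM
  have hBs : G.IsSingular (G.perp z.1 ∩ M) := G.isSingular_inter (G.isSubspace_perp _) hM.prop
  have hB : ∀ x : G.Grassmannian d, x.1 ⊆ M → G.perp z.1 ∩ x.1 = x.1 ∩ (G.perp z.1 ∩ M) := by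
    intro x hx
    ext a
    exact ⟨fun h => ⟨h.2, h.1, hx h.2⟩, fun h => ⟨h.2.1, h.1⟩⟩
  have hiff : ∀ x : G.Grassmannian d, x.1 ⊆ M → ((G.grassmannGraph d).dist z x = 2 ↔
      G.HasHeight (x.1 ∩ (G.perp z.1 ∩ M)) k) := by
    intro x hx
    have hxh := vertex_height hd x
    rw [dist_eq_two_iff hrank hd, hB x hx]
    exact ⟨fun h => h.hasHeight_left (G.isSingular_inter hxh.1.1 hBs) hxh,
      fun h => h.isHyperplane_of_subset hxh Set.inter_subset_left⟩
  have hx₀h := vertex_height hd x₀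
  have hk := (hiff x₀ hx₀M).1 hx₀
  by_cases hBx : G.perp z.1 ∩ M ⊆ x₀.1
  · rw [Set.inter_eq_right.2 hBx] at hk
    refine Or.inr ⟨_, hk, Set.inter_subset_right, fun x hx => (hiff x hx).trans ⟨fun h => ?_,
      fun h => (Set.inter_eq_right.2 h).symm ▸ hk⟩⟩
    rw [← h.eq_of_subset hk Set.inter_subset_right le_rfl]
    exact Set.inter_subset_left
  · have hH := (hx₀h.isHyperplane_of_subset hMh hx₀M).inter
      (Set.inter_subset_right : G.perp z.1 ∩ M ⊆ M) hBx
    obtain ⟨j, -, hj⟩ := hMh.exists_of_subset hBs Set.inter_subset_right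
    obtain rfl := hH.height_eq hk hj
    obtain ⟨t, ht⟩ := exists_vertex hd hj
    rw [← ht] at hiff
    have htM : t.1 ⊆ M := ht ▸ Set.inter_subset_right
    refine Or.inl ⟨t, htM, ht ▸ Set.inter_subset_left, fun x hx => (hiff x hx).trans
      ⟨fun h e => ?_, fun hne => (vertex_height hd x).inter (vertex_height hd t) hMh hx htM
        fun e => hne (Subtype.ext e)⟩⟩
    subst e
    rw [Set.inter_self] at h
    have := h.unique (vertex_height hd x)
    omega

include hrank hd in
/-- For the vertex `r` one takes the join of a hyperplane `A` of `x` and a point of `A^⊥` outside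
`x^⊥`; as `r^⊥ ∩ x = A ⊆ r`, any maximal singular subspace through `r` contains a neighbour
of `x`. -/
theorem exists_close_vertex (hk : 1 ≤ k) (x : G.Grassmannian d) : ∃ r : G.Grassmannian d,
    (G.grassmannGraph d).dist x r = 2 ∧ ∀ N, Maximal G.IsSingular N → r.1 ⊆ N →
      ∃ y : G.Grassmannian d, y.1 ⊆ N ∧ (G.grassmannGraph d).Adj y x := by
  have hx := vertex_height hd x
  obtain ⟨s, hs⟩ := hx.nonempty (by omega)
  obtain ⟨A, hA, hAx, hsA⟩ := hx.exists_hyperplane hs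
  obtain ⟨y, hy, hys⟩ := exists_not_collinear hA.perpClosed
    (fun a ha => hx.1.2 s hs a (hAx ha)) hsA
  have hyA : y ∉ A := fun h => hys (hx.1.2 y (hAx h) s hs)
  have hJ := isHyperplane_adjoin hA.1 hA.perpClosed hy hyA
  have hyJ := insert_subset_adjoin hA.1 hy (Set.mem_insert y A)
  obtain ⟨j, hj⟩ := exists_height hrank (isSingular_adjoin (G := G) (X := A) (p := y))
  obtain rfl := hJ.height_eq hA hj
  obtain ⟨r, hr⟩ := exists_vertex hd hj
  rw [← hr] at hJ hyJ
  have hrh := vertex_height hd r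
  -- `x` and `r` share the hyperplane `A`, and neither is contained in the perp of the other.
  have hxr : G.perp x.1 ∩ r.1 = A := by
    refine hJ.eq_of_subset hrh.1 (G.isSingular_inter (G.isSubspace_perp _) hrh.1).1
      (fun a ha => ⟨fun b hb => hx.1.2 a (hAx ha) b hb, hJ.1 ha⟩) Set.inter_subset_right fun e => ?_
    exact hys (Set.inter_eq_right.1 e hyJ s hs)
  have hrx : G.perp r.1 ∩ x.1 = A := by
    refine (hA.isHyperplane_of_subset hx hAx).eq_of_subset hx.1
      (G.isSingular_inter (G.isSubspace_perp _) hx.1).1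
      (fun a ha => ⟨fun b hb => hrh.1.2 a (hJ.1 ha) b hb, hAx ha⟩) Set.inter_subset_right
      fun e => ?_
    exact hys (G.collinear_symm (Set.inter_eq_right.1 e hs y hyJ))
  refine ⟨r, (dist_eq_two_iff hrank hd).2 (hxr ▸ hJ), fun N hN hrN => ?_⟩
  obtain ⟨w, hwN, -, hwx⟩ := exists_common_neighbor hrank hd
    (hrx ▸ hA.isHyperplane_of_subset hx hAx) hN hrN (hrx ▸ hJ.1.trans hrN)
  exact ⟨w, hwN, hwx⟩

/-- The star geometry on `𝒢_k`: stars consist of the vertices inside a maximal singular subspace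
`M`, lines of the vertices between a subspace of codimension two in `M` and `M`. -/
def starGeometry (hrank : ∀ M, Maximal G.IsSingular M → G.HasHeight M (k + 2)) (hd : d = k)
    (hk : 1 ≤ k) :
    StarGeometry (fun x y : G.Grassmannian d => (G.grassmannGraph d).dist x y = 2) where
  stars := {C | ∃ M, Maximal G.IsSingular M ∧ C = {x | x.1 ⊆ M}}
  lines := {l | ∃ M, Maximal G.IsSingular M ∧ ∃ A, G.HasHeight A k ∧ A ⊆ M ∧
    l = {x | A ⊆ x.1 ∧ x.1 ⊆ M}}
  symm h := by rwa [SimpleGraph.dist_comm]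
  star_unique := by
    rintro _ _ x y ⟨M, hM, rfl⟩ ⟨M', hM', rfl⟩ hxy hx hy hx' hy'
    rw [maximal_eq_of_two hrank hd hM hM' hxy hx hy hx' hy']
  not_dist := by
    rintro _ x y ⟨M, hM, rfl⟩ hx hy h
    exact ((dist_eq_two_iff hrank hd).1 h).2.1
      (Set.inter_eq_right.2 (subset_perp hM.prop hx hy))
  exists_line := by
    rintro _ x y ⟨M, hM, rfl⟩ hx hy hxy
    refine ⟨_, ⟨M, hM, x.1 ∩ y.1, (vertex_height hd x).inter (vertex_height hd y) (hrank M hM) hx hy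
      fun e => hxy (Subtype.ext e), Set.inter_subset_left.trans hx, rfl⟩, fun z hz => hz.2,
      ⟨Set.inter_subset_left, hx⟩, ⟨Set.inter_subset_right, hy⟩⟩
  line_unique := by
    rintro _ _ x y ⟨M, hM, A, hA, -, rfl⟩ ⟨M', hM', A', hA', -, rfl⟩ hxy hx hy hx' hy'
    obtain rfl := maximal_eq_of_two hrank hd hM hM' hxy hx.2 hy.2 hx'.2 hy'.2
    have hi := (vertex_height hd x).inter (vertex_height hd y) (hrank M hM) hx.2 hy.2
      fun e => hxy (Subtype.ext e)
    rw [hA.eq_of_subset hi (Set.subset_inter hx.1 hy.1) le_rfl,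
      hA'.eq_of_subset hi (Set.subset_inter hx'.1 hy'.1) le_rfl]
  exists_third := by
    rintro _ ⟨M, hM, A, hA, hAM, rfl⟩ x y
    obtain ⟨Z, hZ, hAZ, hZM, hZx, hZy⟩ := exists_pencil_third hrank hM hA hAM x.1 y.1
    obtain ⟨z, rfl⟩ := exists_vertex hd hZ
    exact ⟨z, ⟨hAZ, hZM⟩, fun e => hZx (e ▸ rfl), fun e => hZy (e ▸ rfl)⟩
  exists_notMem_line := by
    rintro _ _ ⟨M, hM, rfl⟩ ⟨M', hM', A, hA, hAM, rfl⟩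
    obtain ⟨a, ha⟩ := hA.nonempty hk
    obtain ⟨m, hm⟩ := (hrank M hM).nonempty (by omega)
    obtain ⟨Z, hZ, hZM, haZ⟩ : ∃ Z, G.HasHeight Z (k + 1) ∧ Z ⊆ M ∧ a ∉ Z := by
      by_cases haM : a ∈ M
      · exact (hrank M hM).exists_hyperplane haM
      · obtain ⟨Z, hZ, hZM, -⟩ := (hrank M hM).exists_hyperplane hm
        exact ⟨Z, hZ, hZM, fun h => haM (hZM h)⟩
    obtain ⟨z, rfl⟩ := exists_vertex hd hZ
    exact ⟨z, hZM, fun h => haZ (h.1 ha)⟩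
  exists_line_subset := by
    rintro _ ⟨M, hM, rfl⟩
    obtain ⟨m, hm⟩ := (hrank M hM).nonempty (by omega)
    obtain ⟨Z, hZ, hZM, -⟩ := (hrank M hM).exists_hyperplane hm
    obtain ⟨q, hq⟩ := hZ.nonempty (by omega)
    obtain ⟨A, hA, hAZ, -⟩ := hZ.exists_hyperplane hq
    exact ⟨_, ⟨M, hM, A, hA, hAZ.trans hZM, rfl⟩, fun z hz => hz.2⟩
  exists_other_star := by
    rintro _ x ⟨M, hM, rfl⟩ hx
    have hxh := vertex_height hd x
    obtain ⟨p, hpM, hpx⟩ : ∃ p ∈ M, p ∉ x.1 := by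
      by_contra! h
      have := hxh.unique (Set.Subset.antisymm hx h ▸ hrank M hM)
      omega
    obtain ⟨y, hy, hyp⟩ := exists_not_collinear hxh.perpClosed
      (fun a ha => hM.prop.2 p hpM a (hx ha)) hpx
    obtain ⟨M', hM', hsub⟩ := G.exists_maximal_of_clique (K := insert y x.1) (by
      rintro a (rfl | ha) b (rfl | hb)
      · exact G.collinear_refl _
      · exact hy b hb
      · exact G.collinear_symm (hy a ha)
      · exact hxh.1.2 a ha b hb)
    refine ⟨_, ⟨M', hM', rfl⟩, (Set.subset_insert y x.1).trans hsub, fun e => ?_⟩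
    obtain ⟨q, hq⟩ := hxh.nonempty (by omega)
    obtain ⟨Z, hZ, hZM, hqZ⟩ := (hrank M hM).exists_hyperplane (hx hq)
    obtain ⟨z, rfl⟩ := exists_vertex hd hZ
    have hzM' : z ∈ {x : G.Grassmannian d | x.1 ⊆ M'} := e ▸ hZM
    have hMM := maximal_eq_of_two hrank hd hM hM' (fun (e' : x = z) => hqZ (e' ▸ hq)) hx hZM
      ((Set.subset_insert y x.1).trans hsub) hzM'
    subst hMM
    exact hyp (hM.prop.2 y (hsub (Set.mem_insert y _)) p hpM)
  triangle := by
    rintro _ _ x y z ⟨M, hM, rfl⟩ ⟨M', hM', rfl⟩ hx hy hy' hz h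
    by_cases hxy : x = y
    · subst hxy
      exact ⟨_, ⟨M', hM', rfl⟩, hy', hy', hz⟩
    by_cases hyz : y = z
    · subst hyz
      exact ⟨_, ⟨M, hM, rfl⟩, hx, hy, hy⟩
    by_cases hxz : x = z
    · subst hxz
      exact ⟨_, ⟨M, hM, rfl⟩, hx, hy, hx⟩
    have hadj : (G.grassmannGraph d).Adj x z := by
      by_contra hadj
      exact h (grassmannGraph_dist_eq_two
        ((grassmannGraph_adj_iff hrank hd).2 ⟨hxy, M, hM, hx, hy⟩)
        ((grassmannGraph_adj_iff hrank hd).2 ⟨hyz, M', hM', hy', hz⟩) hxz hadj)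
    obtain ⟨N, hN, h'⟩ := exists_maximal_of_perp (vertex_height hd x).1 (vertex_height hd y).1
      (vertex_height hd z).1 (subset_perp hM.prop hx hy) (subset_perp hM'.prop hy' hz)
      (subset_perp_of_adj hadj)
    exact ⟨_, ⟨N, hN, rfl⟩, h'⟩
  pattern := by
    rintro _ ⟨M, hM, rfl⟩ z
    rcases star_pattern hrank hd hM z with h | ⟨t, htM, htz, h⟩ | ⟨A, hA, hAM, h⟩
    · exact Or.inl h
    · have hzh := (vertex_height hd z).1
      obtain ⟨N, hN, hzN, htN, -⟩ := exists_maximal_of_perp hzh (vertex_height hd t).1 hzh htz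
        (fun a ha b hb => G.collinear_symm (htz hb a ha)) (fun a ha b hb => hzh.2 a ha b hb)
      exact Or.inr (Or.inl ⟨t, htM, ⟨_, ⟨N, hN, rfl⟩, hzN, htN⟩, h⟩)
    · exact Or.inr (Or.inr ⟨_, ⟨M, hM, A, hA, hAM, rfl⟩, fun x hx => hx.2, fun x hx =>
        (h x hx).trans ⟨fun h' => ⟨h', hx⟩, fun h' => h'.1⟩⟩)
  exists_between := by
    intro x z h
    obtain ⟨y, hxy, hyz⟩ := exists_adj_adj_of_dist h
    obtain ⟨-, M, hM, hx, hy⟩ := (grassmannGraph_adj_iff hrank hd).1 hxy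
    obtain ⟨-, M', hM', hy', hz⟩ := (grassmannGraph_adj_iff hrank hd).1 hyz
    exact ⟨y, _, ⟨M, hM, rfl⟩, _, ⟨M', hM', rfl⟩, hx, hy, hy', hz⟩
  exists_close := by
    intro x
    obtain ⟨r, hr, h⟩ := exists_close_vertex hrank hd hk x
    refine ⟨r, hr, ?_⟩
    rintro _ ⟨N, hN, rfl⟩ hrN
    obtain ⟨y, hyN, hyx⟩ := h N hN hrN
    obtain ⟨-, M, hM, hyM, hxM⟩ := (grassmannGraph_adj_iff hrank hd).1 hyx
    exact ⟨y, hyN, _, ⟨M, hM, rfl⟩, hxM, hyM⟩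

theorem starGeometry_adj_iff (hk : 1 ≤ k) {x y : G.Grassmannian d} :
    (starGeometry hrank hd hk).Adj x y ↔ (G.grassmannGraph d).Adj x y := by
  rw [grassmannGraph_adj_iff hrank hd]
  constructor
  · rintro ⟨hxy, _, ⟨M, hM, rfl⟩, hx, hy⟩
    exact ⟨hxy, M, hM, hx, hy⟩
  · rintro ⟨hxy, M, hM, hx, hy⟩
    exact ⟨hxy, _, ⟨M, hM, rfl⟩, hx, hy⟩

end Rank

end PolarSpace

theorem mainTheorem3 {P : Type*} (G : PolarSpace P) (n : ℕ) (hn : 3 ≤ n) (hrank : G.HasRank n)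
    (f : Equiv.Perm (G.Grassmannian ((n : ℤ) - 2)))
    (hf : ∀ S U : G.Grassmannian ((n : ℤ) - 2),
      (G.grassmannGraph ((n : ℤ) - 2)).dist S U = 2 ↔
        (G.grassmannGraph ((n : ℤ) - 2)).dist (f S) (f U) = 2) :
    ∃ φ : G.grassmannGraph ((n : ℤ) - 2) ≃g G.grassmannGraph ((n : ℤ) - 2),
      φ.toEquiv = f := by
  obtain ⟨k, rfl⟩ : ∃ k, n = k + 2 := ⟨n - 2, by omega⟩
  have hrank' : ∀ M, Maximal G.IsSingular M → G.HasHeight M (k + 2) := fun M hM =>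
    (PolarSpace.hasProjDim_iff (by push_cast; omega)).1 (hrank M hM)
  have hd : ((k + 2 : ℕ) : ℤ) - 2 = k := by push_cast; omega
  have hk : 1 ≤ k := by omega
  refine ⟨⟨f, fun {x y} => ?_⟩, rfl⟩
  rw [← PolarSpace.starGeometry_adj_iff hrank' hd hk,
    ← PolarSpace.starGeometry_adj_iff hrank' hd hk]
  exact StarGeometry.adj_iff_of_dist_iff _ f hf x y
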